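/- Let $(X,g)$ be a closed (compact, without boundary) smooth Riemannian manifold with volume measure $dv_g$, and let $E,F$ be smooth real vector bundles of finite rank over $X$ with smooth fibre metrics. Let $D:\Gamma(E)\to\Gamma(F)$ be a first order elliptic differential operator on smooth sections, with symbol $\sigma:T^*X\to\mathrm{Hom}(E,F)$ defined by $D(f\xi)=\sigma(df)\xi+fD\xi$ for all $f\in C^\infty(X)$, $\xi\in\Gamma(E)$; ellipticity means that $\sigma(u)$ is an isomorphism for every covector $u\neq 0$. Let $\mathcal A:E\to F$ be a smooth real bundle map, and put $D_s=D+s\mathcal A$ for $s\in\mathbb R$. Suppose that $(\sigma,\mathcal A)$ is a concentrating pair, i.e. $\mathcal A^*\circ\sigma(u)=\sigma(u)^*\circ\mathcal A$ for every $u\in T^*X$. Let $Z_{\mathcal A}=\{x\in X : \ker\mathcal A(x)\neq 0\}$ be the singular set of $\mathcal A$ and, for $\delta>0$, let $\Omega(\delta)=X\setminus Z(\delta)$, where $Z(\delta)$ is the open $\delta$-neighbourhood of $Z_{\mathcal A}$ for the Riemannian distance. Write $\|\cdot\|_2$ for the $L^2$ norms of sections. Then for every $\delta>0$ and $C\ge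 0$ there is a constant $C'>0$ (depending on $\delta$, $C$ and the data $X,g,E,F,D,\mathcal A$, but not on $s$ or $\xi$) such that for every real $s\neq 0$ and every $\xi\in C^\infty(E)$ with $\|\xi\|_2=1$ and $\|D_s\xi\|_2^2\le C|s|$, $$\int_{\Omega(\delta)}|\xi|^2\,dv_g<\frac{C'}{|s|}.$$ -/

import Mathlib

open Bundle Manifold MeasureTheory
open scoped ContDiff ENNReal

noncomputable section

namespace Concentration

/-! ### The Riemannian volume measure -/

section Volume

variable {n : ℕ} {X : Type*} [TopologicalSpace X] [ChartedSpace (EuclideanSpace ℝ (Fin n)) X]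
  [RiemannianBundle (fun x : X ↦ TangentSpace (𝓡 n) x)]

/-- The coordinate vector field `∂ᵢ` of the preferred chart at `x₀`, at the point with
coordinates `y`. -/
def coordVector (x₀ : X) (y : EuclideanSpace ℝ (Fin n)) (i : Fin n) :
    TangentSpace (𝓡 n) ((extChartAt (𝓡 n) x₀).symm y) :=
  mfderiv 𝓘(ℝ, EuclideanSpace ℝ (Fin n)) (𝓡 n) (extChartAt (𝓡 n) x₀).symm y
    (EuclideanSpace.single i (1 : ℝ))

/-- The Riemannian density `√(det (gᵢⱼ))` in the preferred chart at `x₀`. -/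
def volumeDensity (x₀ : X) (y : EuclideanSpace ℝ (Fin n)) : ℝ :=
  √((Matrix.of fun i j : Fin n ↦ inner ℝ (coordVector x₀ y i) (coordVector x₀ y j)).det)

variable [MeasurableSpace X]

/-- The measure `√(det (gᵢⱼ)) dy¹ ⋯ dyⁿ` on the domain of the preferred chart at `x₀`,
regarded as a measure on `X`. -/
def chartVolume (x₀ : X) : Measure X :=
  ((volume.restrict (extChartAt (𝓡 n) x₀).target).withDensity
    fun y ↦ ENNReal.ofReal (volumeDensity x₀ y)).map (extChartAt (𝓡 n) x₀).symm

variable (n X) in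
/-- The Riemannian volume measure `dv_g`. By the change of variables formula the chart measures
agree on overlaps, so their supremum in the lattice of measures is the measure which restricts
to `chartVolume x₀` on the domain of each chart. -/
def riemannianVolume : Measure X := ⨆ x₀ : X, chartVolume (n := n) x₀

end Volume

/-! ### Operators between sections of vector bundles -/

section Operators

variable {n : ℕ} {X : Type*} [TopologicalSpace X] [ChartedSpace (EuclideanSpace ℝ (Fin n)) X]
  [IsManifold (𝓡 n) ∞ X]
  {VE : Type*} [NormedAddCommGroup VE] [NormedSpace ℝ VE]
  {E : X → Type*} [TopologicalSpace (TotalSpace VE E)] [∀ x, NormedAddCommGroup (E x)]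
  [∀ x, InnerProductSpace ℝ (E x)] [FiberBundle VE E] [VectorBundle ℝ VE E]
  {VF : Type*} [NormedAddCommGroup VF] [NormedSpace ℝ VF]
  {F : X → Type*} [TopologicalSpace (TotalSpace VF F)] [∀ x, NormedAddCommGroup (F x)]
  [∀ x, InnerProductSpace ℝ (F x)] [FiberBundle VF F] [VectorBundle ℝ VF F]

/-- The product `f ξ` of a smooth function and a smooth section. -/
def smulSection (f : C^∞⟮𝓡 n, X; ℝ⟯) (ξ : Cₛ^∞⟮𝓡 n; VE, E⟯) : Cₛ^∞⟮𝓡 n; VE, E⟯ :=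
  ⟨fun x ↦ f x • ξ x, f.contMDiff.smul_section ξ.contMDiff⟩

/-- `σ` is the symbol of the first order differential operator `D`:
`D (f ξ) = σ(df) ξ + f D ξ` for all smooth functions `f` and smooth sections `ξ`.
A linear operator between spaces of smooth sections is a differential operator of order at most one
exactly if it has a symbol in this sense, and the symbol is then unique. -/
def HasSymbol (D : Cₛ^∞⟮𝓡 n; VE, E⟯ →ₗ[ℝ] Cₛ^∞⟮𝓡 n; VF, F⟯)
    (σ : ∀ x : X, (TangentSpace (𝓡 n) x →L[ℝ] ℝ) →ₗ[ℝ] (E x →L[ℝ] F x)) : Prop :=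
  ∀ (f : C^∞⟮𝓡 n, X; ℝ⟯) (ξ : Cₛ^∞⟮𝓡 n; VE, E⟯) (x : X),
    D (smulSection f ξ) x = σ x (mvfderiv (𝓡 n) f x) (ξ x) + f x • D ξ x

/-- Ellipticity: the symbol of every nonzero covector is an isomorphism. -/
def IsElliptic (σ : ∀ x : X, (TangentSpace (𝓡 n) x →L[ℝ] ℝ) →ₗ[ℝ] (E x →L[ℝ] F x)) : Prop :=
  ∀ (x : X) (u : TangentSpace (𝓡 n) x →L[ℝ] ℝ), u ≠ 0 → Function.Bijective (σ x u)

variable (VE) in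
theorem completeSpace_fiber [FiniteDimensional ℝ VE] (x : X) : CompleteSpace (E x) :=
  have : FiniteDimensional ℝ (E x) := FiniteDimensional.of_injective
    ((trivializationAt VE E x).continuousLinearEquivAt ℝ x
      (mem_baseSet_trivializationAt VE E x)).toLinearEquiv.toLinearMap
    ((trivializationAt VE E x).continuousLinearEquivAt ℝ x
      (mem_baseSet_trivializationAt VE E x)).injective
  FiniteDimensional.complete ℝ (E x)

/-- `(σ, A)` is a concentrating pair: `A* ∘ σ(u) = σ(u)* ∘ A` for every covector `u`, with
adjoints taken with respect to the metrics on the fibers of `E` and `F`. -/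
def IsConcentratingPair [FiniteDimensional ℝ VE] [FiniteDimensional ℝ VF]
    (σ : ∀ x : X, (TangentSpace (𝓡 n) x →L[ℝ] ℝ) →ₗ[ℝ] (E x →L[ℝ] F x))
    (A : Cₛ^∞⟮𝓡 n; VE →L[ℝ] VF, fun x ↦ E x →L[ℝ] F x⟯) : Prop :=
  ∀ (x : X) (u : TangentSpace (𝓡 n) x →L[ℝ] ℝ),
    haveI := completeSpace_fiber VE (E := E) x
    haveI := completeSpace_fiber VF (E := F) x
    (A x).adjoint ∘L σ x u = (σ x u).adjoint ∘L A x

/-- The operator on smooth sections given by a smooth bundle map `A : E → F`. -/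
def bundleMapOp (A : Cₛ^∞⟮𝓡 n; VE →L[ℝ] VF, fun x ↦ E x →L[ℝ] F x⟯) :
    Cₛ^∞⟮𝓡 n; VE, E⟯ →ₗ[ℝ] Cₛ^∞⟮𝓡 n; VF, F⟯ where
  toFun ξ := ⟨fun x ↦ A x (ξ x), A.contMDiff.clm_bundle_apply ξ.contMDiff⟩
  map_add' ξ η := by ext x; exact (A x).map_add (ξ x) (η x)
  map_smul' c ξ := by ext x; exact (A x).map_smul c (ξ x)

/-- The family `D_s = D + s A`. -/
def perturbedOp (D : Cₛ^∞⟮𝓡 n; VE, E⟯ →ₗ[ℝ] Cₛ^∞⟮𝓡 n; VF, F⟯)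
    (A : Cₛ^∞⟮𝓡 n; VE →L[ℝ] VF, fun x ↦ E x →L[ℝ] F x⟯) (s : ℝ) :
    Cₛ^∞⟮𝓡 n; VE, E⟯ →ₗ[ℝ] Cₛ^∞⟮𝓡 n; VF, F⟯ :=
  D + s • bundleMapOp A

/-- The singular set `Z_A` of points at which `A` has nonzero kernel. -/
def singularSet (A : Cₛ^∞⟮𝓡 n; VE →L[ℝ] VF, fun x ↦ E x →L[ℝ] F x⟯) : Set X :=
  {x | LinearMap.ker (A x).toLinearMap ≠ ⊥}

/-- The `L²` norm of a smooth section. -/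
def l2Norm [RiemannianBundle (fun x : X ↦ TangentSpace (𝓡 n) x)] [MeasurableSpace X]
    (ξ : Cₛ^∞⟮𝓡 n; VE, E⟯) : ℝ :=
  √(∫ x, ‖ξ x‖ ^ 2 ∂(riemannianVolume n X))

end Operators

end Concentration

end

/-!
Expanding `‖(D + s A) ξ‖² = ‖D ξ‖² + 2 s ⟨D ξ, A ξ⟩ + s² ‖A ξ‖²`, everything rests on a bound
`|⟨D ξ, A ξ⟩| ≤ C₁ ‖ξ‖²` without derivatives of `ξ`. Replacing `ξ`, `η` by `f ξ`, `g η` in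
`⟨D ξ, A η⟩ + ⟨D η, A ξ⟩`, the Leibniz rule produces the derivatives
`g ⟨σ(df) ξ, A η⟩ + f ⟨σ(dg) η, A ξ⟩`, and the concentrating condition says exactly that
`⟨σ(u) ξ, A η⟩` is symmetric in `ξ` and `η`, so that they add up to `⟨σ(d(fg)) ξ, A η⟩`: a smooth
vector field applied to the function `f g`. Integrating by parts bounds its integral by the `L¹`
norm of `f g`. Writing a section as `ξ = ∑ cₐ(ξ) eₐ` with finitely many fixed sections `eₐ` and
`|cₐ(ξ)| ≤ B |ξ|` gives the bound on the cross term, hence `s² ‖A ξ‖² ≤ ‖D_s ξ‖² + 2 |s| C₁ ‖ξ‖²`.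
On a compact set away from the singular set `A` is bounded below, so `‖A ξ‖²` controls the integral
of `|ξ|²` there.
-/

noncomputable section

namespace Concentration

open Set Filter Topology

section Charts

variable {V : Type*} [NormedAddCommGroup V] [NormedSpace ℝ V]
  {M : Type*} [TopologicalSpace M] [ChartedSpace V M] [IsManifold 𝓘(ℝ, V) ∞ M]

lemma mfderiv_extChartAt_symm_injective (x₀ : M) {y : V}
    (hy : y ∈ (extChartAt 𝓘(ℝ, V) x₀).target) :
    Function.Injective (mfderiv 𝓘(ℝ, V) 𝓘(ℝ, V) (extChartAt 𝓘(ℝ, V) x₀).symm y) := by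
  have h := isInvertible_mfderivWithin_extChartAt_symm (I := 𝓘(ℝ, V)) hy
  simp only [modelWithCornersSelf_coe, range_id, mfderivWithin_univ] at h
  exact h.injective

lemma mdifferentiableAt_extChartAt_symm (x₀ : M) {y : V}
    (hy : y ∈ (extChartAt 𝓘(ℝ, V) x₀).target) :
    MDifferentiableAt 𝓘(ℝ, V) 𝓘(ℝ, V) (extChartAt 𝓘(ℝ, V) x₀).symm y :=
  ((contMDiffOn_extChartAt_symm (I := 𝓘(ℝ, V)) (n := ∞) x₀).contMDiffAt
    ((isOpen_extChartAt_target x₀).mem_nhds hy)).mdifferentiableAt (by simp)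

lemma contMDiffOn_mfderiv_extChartAt_symm (x₀ : M) (v : V) :
    ContMDiffOn 𝓘(ℝ, V) 𝓘(ℝ, V).tangent ∞
      (fun y ↦ (⟨(extChartAt 𝓘(ℝ, V) x₀).symm y,
        mfderiv 𝓘(ℝ, V) 𝓘(ℝ, V) (extChartAt 𝓘(ℝ, V) x₀).symm y v⟩ : TangentBundle 𝓘(ℝ, V) M))
      (extChartAt 𝓘(ℝ, V) x₀).target := by
  have hopen : IsOpen (extChartAt 𝓘(ℝ, V) x₀).target := isOpen_extChartAt_target x₀
  have htangent := (contMDiffOn_extChartAt_symm (I := 𝓘(ℝ, V)) (n := ∞)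
    x₀).contMDiffOn_tangentMapWithin (m := ∞) (by simp) hopen.uniqueMDiffOn
  have hconst : ContMDiff 𝓘(ℝ, V) 𝓘(ℝ, V).tangent ∞
      (fun y ↦ (⟨y, v⟩ : TangentBundle 𝓘(ℝ, V) V)) :=
    contMDiff_vectorSpace_iff_contDiff.2 contDiff_const
  refine (htangent.comp hconst.contMDiffOn fun y hy ↦ hy).congr fun y hy ↦ ?_
  simp only [Function.comp, tangentMapWithin]
  rw [mfderivWithin_of_isOpen hopen hy]

lemma mdifferentiableAt_extChartAt_comp_symm (x₀ x₁ : M) {y : V}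
    (hy : y ∈ (extChartAt 𝓘(ℝ, V) x₀).target)
    (hy' : (extChartAt 𝓘(ℝ, V) x₀).symm y ∈ (extChartAt 𝓘(ℝ, V) x₁).source) :
    MDifferentiableAt 𝓘(ℝ, V) 𝓘(ℝ, V)
      (extChartAt 𝓘(ℝ, V) x₁ ∘ (extChartAt 𝓘(ℝ, V) x₀).symm) y :=
  (((contMDiffOn_extChartAt (I := 𝓘(ℝ, V)) (n := ∞) (x := x₁)).contMDiffAt
    ((chartAt _ x₁).open_source.mem_nhds
      (by simpa using hy'))).mdifferentiableAt (by simp)).comp y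
        (mdifferentiableAt_extChartAt_symm x₀ hy)

lemma mfderiv_extChartAt_symm_eq_comp (x₀ x₁ : M) {y : V}
    (hy : y ∈ (extChartAt 𝓘(ℝ, V) x₀).target)
    (hy' : (extChartAt 𝓘(ℝ, V) x₀).symm y ∈ (extChartAt 𝓘(ℝ, V) x₁).source) (v : V) :
    (mfderiv 𝓘(ℝ, V) 𝓘(ℝ, V) (extChartAt 𝓘(ℝ, V) x₀).symm y v : V) =
      mfderiv 𝓘(ℝ, V) 𝓘(ℝ, V) (extChartAt 𝓘(ℝ, V) x₁).symm
        (extChartAt 𝓘(ℝ, V) x₁ ((extChartAt 𝓘(ℝ, V) x₀).symm y))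
        (fderiv ℝ (extChartAt 𝓘(ℝ, V) x₁ ∘ (extChartAt 𝓘(ℝ, V) x₀).symm) y v) := by
  set φ₀ := extChartAt 𝓘(ℝ, V) x₀
  set φ₁ := extChartAt 𝓘(ℝ, V) x₁
  have hfactor : φ₁.symm ∘ (φ₁ ∘ φ₀.symm) =ᶠ[𝓝 y] φ₀.symm := by
    have hc : ContinuousAt φ₀.symm y := (mdifferentiableAt_extChartAt_symm x₀ hy).continuousAt
    filter_upwards [hc.preimage_mem_nhds ((isOpen_extChartAt_source x₁).mem_nhds hy')] with z hz
    exact φ₁.left_inv hz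
  have hchain := mfderiv_comp y (mdifferentiableAt_extChartAt_symm x₁ (φ₁.map_source hy'))
    (mdifferentiableAt_extChartAt_comp_symm x₀ x₁ hy hy')
  rw [hfactor.mfderiv_eq, mfderiv_eq_fderiv] at hchain
  exact congrArg (fun L : V →L[ℝ] V ↦ L v) hchain

end Charts

section Gram

variable {𝕜 : Type*} [RCLike 𝕜] {H : Type*} [NormedAddCommGroup H] [InnerProductSpace 𝕜 H]
  {ι κ : Type*} [Fintype κ]

lemma gram_sum_smul (M : Matrix κ ι 𝕜) (w : κ → H) :
    Matrix.gram 𝕜 (fun i ↦ ∑ k, M k i • w k) = M.conjTranspose * Matrix.gram 𝕜 w * M := by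
  ext i j
  rw [Matrix.gram_apply, ← Matrix.star_dotProduct_gram_mulVec w (M · i) (M · j), Matrix.mul_assoc]
  rfl

lemma det_gram_comp_basis [DecidableEq κ] {V : Type*} [AddCommGroup V] [Module 𝕜 V]
    (b : Module.Basis κ 𝕜 V) (T : V →ₗ[𝕜] H) (J : V →ₗ[𝕜] V) :
    (Matrix.gram 𝕜 fun i ↦ T (J (b i))).det =
      star (LinearMap.det J) * LinearMap.det J * (Matrix.gram 𝕜 fun i ↦ T (b i)).det := by
  have hJ : ∀ i, T (J (b i)) = ∑ k, LinearMap.toMatrix b b J k i • T (b k) := fun i ↦ by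
    simp_rw [LinearMap.toMatrix_apply, ← map_smul, ← map_sum, b.sum_repr]
  simp_rw [hJ, gram_sum_smul, Matrix.det_mul, Matrix.det_conjTranspose, LinearMap.det_toMatrix]
  ring

end Gram

section VolumeDensity

variable {n : ℕ} {X : Type*} [TopologicalSpace X] [ChartedSpace (EuclideanSpace ℝ (Fin n)) X]
  [RiemannianBundle (fun x : X ↦ TangentSpace (𝓡 n) x)]

-- Naming the base point `p` lets Gram matrices taken in different charts be compared in one
-- tangent space.
lemma volumeDensity_eq_sqrt_det_gram (x₀ : X) {y : EuclideanSpace ℝ (Fin n)} {p : X}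
    (hp : (extChartAt (𝓡 n) x₀).symm y = p) :
    volumeDensity x₀ y =
      √(Matrix.gram ℝ (E := TangentSpace (𝓡 n) p) (coordVector x₀ y)).det := by
  subst hp
  rfl

lemma volumeDensity_nonneg (x₀ : X) (y : EuclideanSpace ℝ (Fin n)) : 0 ≤ volumeDensity x₀ y :=
  Real.sqrt_nonneg _

variable [IsManifold (𝓡 n) ∞ X]

lemma volumeDensity_pos (x₀ : X) {y : EuclideanSpace ℝ (Fin n)}
    (hy : y ∈ (extChartAt (𝓡 n) x₀).target) : 0 < volumeDensity x₀ y := by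
  have hbasis : LinearIndependent ℝ fun i : Fin n ↦ EuclideanSpace.single i (1 : ℝ) := by
    simpa only [OrthonormalBasis.coe_toBasis,
      funext (EuclideanSpace.basisFun_apply (Fin n) ℝ)] using
      (EuclideanSpace.basisFun (Fin n) ℝ).toBasis.linearIndependent
  have hcoord : LinearIndependent ℝ (coordVector x₀ y) :=
    hbasis.map' (mfderiv 𝓘(ℝ, EuclideanSpace ℝ (Fin n)) (𝓡 n)
      (extChartAt (𝓡 n) x₀).symm y).toLinearMap
      (LinearMap.ker_eq_bot.2 (mfderiv_extChartAt_symm_injective x₀ hy))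
  exact Real.sqrt_pos.2 (Matrix.posDef_gram_of_linearIndependent hcoord).det_pos

lemma contDiffOn_volumeDensity [IsContMDiffRiemannianBundle (𝓡 n) ∞ (EuclideanSpace ℝ (Fin n))
      (fun x : X ↦ TangentSpace (𝓡 n) x)] (x₀ : X) :
    ContDiffOn ℝ ∞ (volumeDensity x₀) (extChartAt (𝓡 n) x₀).target := by
  have hcoord : ∀ i : Fin n, ContMDiffOn 𝓘(ℝ, EuclideanSpace ℝ (Fin n)) (𝓡 n).tangent ∞
      (fun y ↦ (⟨(extChartAt (𝓡 n) x₀).symm y, coordVector x₀ y i⟩ :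
        TangentBundle (𝓡 n) X)) (extChartAt (𝓡 n) x₀).target :=
    fun i ↦ contMDiffOn_mfderiv_extChartAt_symm x₀ _
  have hmetric : ∀ i j : Fin n, ContDiffOn ℝ ∞
      (fun y ↦ inner ℝ (coordVector x₀ y i) (coordVector x₀ y j)) (extChartAt (𝓡 n) x₀).target :=
    fun i j ↦ contMDiffOn_iff_contDiffOn.1 ((hcoord i).inner_bundle (hcoord j))
  unfold volumeDensity
  refine ContDiffOn.sqrt ?_ fun y hy ↦ (Real.sqrt_pos.1 (volumeDensity_pos x₀ hy)).ne'
  simp only [Matrix.det_apply]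
  exact ContDiffOn.sum fun τ _ ↦ ContDiffOn.const_smul _ (contDiffOn_prod fun i _ ↦ hmetric _ _)

lemma volumeDensity_eq_abs_det_mul (x₀ x₁ : X) {y : EuclideanSpace ℝ (Fin n)}
    (hy : y ∈ (extChartAt (𝓡 n) x₀).target)
    (hy' : (extChartAt (𝓡 n) x₀).symm y ∈ (extChartAt (𝓡 n) x₁).source) :
    volumeDensity x₀ y =
      |(fderiv ℝ (extChartAt (𝓡 n) x₁ ∘ (extChartAt (𝓡 n) x₀).symm) y).det| *
        volumeDensity x₁ ((extChartAt (𝓡 n) x₁) ((extChartAt (𝓡 n) x₀).symm y)) := by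
  set φ₀ := extChartAt (𝓡 n) x₀
  set φ₁ := extChartAt (𝓡 n) x₁
  let J := fderiv ℝ (φ₁ ∘ φ₀.symm) y
  let T : EuclideanSpace ℝ (Fin n) →L[ℝ] TangentSpace (𝓡 n) (φ₀.symm y) :=
    mfderiv 𝓘(ℝ, EuclideanSpace ℝ (Fin n)) (𝓡 n) φ₁.symm (φ₁ (φ₀.symm y))
  have hcoord : coordVector x₀ y = fun i ↦ T (J (EuclideanSpace.single i 1)) :=
    funext fun i ↦ mfderiv_extChartAt_symm_eq_comp x₀ x₁ hy hy' _
  have hdet := det_gram_comp_basis (EuclideanSpace.basisFun (Fin n) ℝ).toBasis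
    T.toLinearMap J.toLinearMap
  simp only [OrthonormalBasis.coe_toBasis, EuclideanSpace.basisFun_apply,
    ContinuousLinearMap.coe_coe, star_trivial] at hdet
  rw [volumeDensity_eq_sqrt_det_gram x₀ rfl, volumeDensity_eq_sqrt_det_gram x₁ (φ₁.left_inv hy'),
    hcoord, hdet, Real.sqrt_mul (mul_self_nonneg _), Real.sqrt_mul_self_eq_abs]
  rfl

end VolumeDensity

lemma measurableSet_preimage_inter_of_continuousOn {Y Z : Type*} [TopologicalSpace Y]
    [MeasurableSpace Y] [OpensMeasurableSpace Y] [TopologicalSpace Z] [MeasurableSpace Z]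
    [BorelSpace Z] {f : Y → Z} {s : Set Y} {t : Set Z} (hf : ContinuousOn f s)
    (hs : MeasurableSet s) (ht : MeasurableSet t) : MeasurableSet (f ⁻¹' t ∩ s) := by
  have h := hs.subtype_image (hf.domRestrict.measurable ht)
  rwa [domRestrict_eq, preimage_comp, Subtype.image_preimage_coe, inter_comm] at h

section VolumeMeasure

variable {n : ℕ} {X : Type*} [TopologicalSpace X] [ChartedSpace (EuclideanSpace ℝ (Fin n)) X]

lemma measurableSet_extChartAt_target (x₀ : X) :
    MeasurableSet (extChartAt (𝓡 n) x₀).target :=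
  (isOpen_extChartAt_target x₀).measurableSet

variable [RiemannianBundle (fun x : X ↦ TangentSpace (𝓡 n) x)] [MeasurableSpace X] [BorelSpace X]

lemma aemeasurable_extChartAt_symm (x₀ : X) :
    AEMeasurable (extChartAt (𝓡 n) x₀).symm
      ((volume.restrict (extChartAt (𝓡 n) x₀).target).withDensity
        fun y ↦ ENNReal.ofReal (volumeDensity x₀ y)) :=
  ((continuousOn_extChartAt_symm x₀).aemeasurable
    (measurableSet_extChartAt_target x₀)).mono_ac (withDensity_absolutelyContinuous _ _)

lemma chartVolume_apply (x₀ : X) {S : Set X} (hS : MeasurableSet S) :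
    chartVolume (n := n) x₀ S =
      ∫⁻ y in (extChartAt (𝓡 n) x₀).symm ⁻¹' S ∩ (extChartAt (𝓡 n) x₀).target,
        ENNReal.ofReal (volumeDensity x₀ y) := by
  rw [chartVolume, Measure.map_apply_of_aemeasurable (aemeasurable_extChartAt_symm x₀) hS,
    withDensity_apply', Measure.restrict_restrict' (measurableSet_extChartAt_target x₀)]

lemma chartVolume_compl_source (x₀ : X) :
    chartVolume (n := n) x₀ (extChartAt (𝓡 n) x₀).sourceᶜ = 0 := by
  have hempty : (extChartAt (𝓡 n) x₀).symm ⁻¹' (extChartAt (𝓡 n) x₀).sourceᶜ ∩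
      (extChartAt (𝓡 n) x₀).target = ∅ :=
    eq_empty_of_forall_notMem fun _ hy ↦ hy.1 ((extChartAt (𝓡 n) x₀).map_target hy.2)
  rw [chartVolume_apply x₀ (isOpen_extChartAt_source x₀).measurableSet.compl, hempty,
    Measure.restrict_empty, lintegral_zero_measure]

variable [IsManifold (𝓡 n) ∞ X]

lemma chartVolume_inter_source_le (x₀ x₁ : X) {S : Set X} (hS : MeasurableSet S) :
    chartVolume (n := n) x₀ (S ∩ (extChartAt (𝓡 n) x₁).source) ≤ chartVolume (n := n) x₁ S := by
  set φ₀ := extChartAt (𝓡 n) x₀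
  set φ₁ := extChartAt (𝓡 n) x₁
  have hsource : MeasurableSet (S ∩ φ₁.source) :=
    hS.inter (isOpen_extChartAt_source x₁).measurableSet
  rw [chartVolume_apply x₀ hsource, chartVolume_apply x₁ hS]
  set s := φ₀.symm ⁻¹' (S ∩ φ₁.source) ∩ φ₀.target
  have hs : MeasurableSet s := measurableSet_preimage_inter_of_continuousOn
    (continuousOn_extChartAt_symm x₀) (measurableSet_extChartAt_target x₀) hsource
  have hderiv : ∀ y ∈ s, HasFDerivWithinAt (φ₁ ∘ φ₀.symm) (fderiv ℝ (φ₁ ∘ φ₀.symm) y) s y :=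
    fun y hy ↦ (mdifferentiableAt_iff_differentiableAt.1
      (mdifferentiableAt_extChartAt_comp_symm x₀ x₁ hy.2 hy.1.2)).hasFDerivAt.hasFDerivWithinAt
  have hinj : InjOn (φ₁ ∘ φ₀.symm) s := fun y hy z hz hyz ↦
    φ₀.symm.injOn hy.2 hz.2 (φ₁.injOn hy.1.2 hz.1.2 hyz)
  have himage : (φ₁ ∘ φ₀.symm) '' s ⊆ φ₁.symm ⁻¹' S ∩ φ₁.target := by
    rintro _ ⟨y, hy, rfl⟩
    refine ⟨?_, φ₁.map_source hy.1.2⟩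
    rw [mem_preimage, Function.comp_apply, φ₁.left_inv hy.1.2]
    exact hy.1.1
  calc ∫⁻ y in s, ENNReal.ofReal (volumeDensity x₀ y)
      = ∫⁻ y in s, ENNReal.ofReal |(fderiv ℝ (φ₁ ∘ φ₀.symm) y).det| *
          ENNReal.ofReal (volumeDensity x₁ ((φ₁ ∘ φ₀.symm) y)) := by
        refine setLIntegral_congr_fun hs fun y hy ↦ ?_
        rw [volumeDensity_eq_abs_det_mul x₀ x₁ hy.2 hy.1.2, ENNReal.ofReal_mul (abs_nonneg _)]
        rfl
    _ = ∫⁻ z in (φ₁ ∘ φ₀.symm) '' s, ENNReal.ofReal (volumeDensity x₁ z) :=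
        (lintegral_image_eq_lintegral_abs_det_fderiv_mul volume hs hderiv hinj
          fun z ↦ ENNReal.ofReal (volumeDensity x₁ z)).symm
    _ ≤ ∫⁻ z in φ₁.symm ⁻¹' S ∩ φ₁.target, ENNReal.ofReal (volumeDensity x₁ z) :=
        lintegral_mono_set himage

lemma riemannianVolume_restrict_source (x₀ : X) :
    (riemannianVolume n X).restrict (extChartAt (𝓡 n) x₀).source =
      chartVolume (n := n) x₀ := by
  have hsource : MeasurableSet (extChartAt (𝓡 n) x₀).source :=
    (isOpen_extChartAt_source x₀).measurableSet
  apply le_antisymm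
  · have hle : riemannianVolume n X ≤
        chartVolume (n := n) x₀ + (⊤ : Measure X).restrict (extChartAt (𝓡 n) x₀).sourceᶜ := by
      refine iSup_le fun x ↦ Measure.le_iff.2 fun S hS ↦ ?_
      rw [← measure_inter_add_sdiff S hsource, Measure.add_apply, Measure.restrict_apply hS]
      exact add_le_add (chartVolume_inter_source_le x x₀ hS)
        ((le_top : chartVolume (n := n) x ≤ ⊤) _)
    refine (Measure.restrict_mono le_rfl hle).trans ?_
    rw [Measure.restrict_add, Measure.restrict_restrict hsource, inter_compl_self,
      Measure.restrict_empty, add_zero]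
    exact Measure.restrict_le_self
  · rw [← Measure.restrict_eq_self_of_ae_mem (μ := chartVolume (n := n) x₀)
      (s := (extChartAt (𝓡 n) x₀).source) (chartVolume_compl_source x₀)]
    exact Measure.restrict_mono le_rfl (le_iSup (fun x ↦ chartVolume (n := n) x) x₀)

variable [IsContMDiffRiemannianBundle (𝓡 n) ∞ (EuclideanSpace ℝ (Fin n))
      (fun x : X ↦ TangentSpace (𝓡 n) x)]

lemma setIntegral_source_riemannianVolume {G : Type*} [NormedAddCommGroup G] [NormedSpace ℝ G]
    (x₀ : X) {g : X → G} (hg : AEStronglyMeasurable g (riemannianVolume n X)) :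
    ∫ x in (extChartAt (𝓡 n) x₀).source, g x ∂(riemannianVolume n X) =
      ∫ y in (extChartAt (𝓡 n) x₀).target,
        volumeDensity x₀ y • g ((extChartAt (𝓡 n) x₀).symm y) := by
  have hgc : AEStronglyMeasurable g (chartVolume (n := n) x₀) :=
    riemannianVolume_restrict_source (n := n) x₀ ▸ hg.restrict
  rw [riemannianVolume_restrict_source, chartVolume,
    integral_map (aemeasurable_extChartAt_symm x₀) hgc,
    integral_withDensity_eq_integral_toReal_smul₀
      ((contDiffOn_volumeDensity x₀).continuousOn.aemeasurable
        (measurableSet_extChartAt_target x₀)).ennreal_ofReal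
      (Eventually.of_forall fun _ ↦ ENNReal.ofReal_lt_top)]
  simp only [ENNReal.toReal_ofReal (volumeDensity_nonneg x₀ _)]

instance isLocallyFiniteMeasure_riemannianVolume :
    IsLocallyFiniteMeasure (riemannianVolume n X) := by
  refine ⟨fun x ↦ ?_⟩
  set φ := extChartAt (𝓡 n) x
  obtain ⟨K, hK, hKx, hKt⟩ := exists_compact_subset (isOpen_extChartAt_target (I := 𝓡 n) x)
    (mem_extChartAt_target (I := 𝓡 n) x)
  have hopen : IsOpen (φ.source ∩ φ ⁻¹' interior K) := isOpen_extChartAt_preimage' x isOpen_interior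
  have hsubset : φ.symm ⁻¹' (φ.source ∩ φ ⁻¹' interior K) ∩ φ.target ⊆ K := fun y hy ↦ by
    have hyK : φ (φ.symm y) ∈ interior K := hy.1.2
    rw [φ.right_inv hy.2] at hyK
    exact interior_subset hyK
  refine ⟨φ.source ∩ φ ⁻¹' interior K, hopen.mem_nhds ⟨mem_extChartAt_source x, hKx⟩, ?_⟩
  rw [← Measure.restrict_eq_self (riemannianVolume n X) inter_subset_left,
    riemannianVolume_restrict_source, chartVolume_apply x hopen.measurableSet]
  exact (lintegral_mono_set hsubset).trans_lt
    (((contDiffOn_volumeDensity x).continuousOn.mono hKt).integrableOn_compact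
      hK).setLIntegral_lt_top

end VolumeMeasure

section Euclidean

variable {V : Type*} [NormedAddCommGroup V] [MeasurableSpace V] {U : Set V}

lemma setIntegral_mul_eq_integral_of_tsupport_subset {μ : Measure V} (f : V → ℝ) {h : V → ℝ}
    (hs : tsupport h ⊆ U) : ∫ y in U, f y * h y ∂μ = ∫ y, f y * h y ∂μ :=
  setIntegral_eq_integral_of_forall_compl_eq_zero fun y hy ↦ by
    rw [image_eq_zero_of_notMem_tsupport fun hmem ↦ hy (hs hmem), mul_zero]

variable [BorelSpace V] {K : Set V}

lemma integrable_mul_of_tsupport_subset {μ : Measure V} [IsFiniteMeasureOnCompacts μ]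
    (hU : IsOpen U) (hK : IsCompact K) (hKU : K ⊆ U) {f h : V → ℝ} (hf : ContinuousOn f U)
    (hh : Continuous h) (hs : tsupport h ⊆ K) : Integrable (fun y ↦ f y * h y) μ := by
  have hsupp : tsupport (fun y ↦ f y * h y) ⊆ tsupport h := tsupport_mul_subset_right
  refine Continuous.integrable_of_hasCompactSupport ?_
    (hK.of_isClosed_subset (isClosed_tsupport _) (hsupp.trans hs))
  exact continuous_of_tsupport fun y hy ↦
    (hf.continuousAt (hU.mem_nhds (hKU (hs (hsupp hy))))).mul hh.continuousAt

variable [NormedSpace ℝ V]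

lemma integrable_mul_fderiv_of_tsupport_subset {μ : Measure V} [IsFiniteMeasureOnCompacts μ]
    (hU : IsOpen U) (hK : IsCompact K) (hKU : K ⊆ U) {f h : V → ℝ} (hf : ContinuousOn f U)
    (hh : ContDiff ℝ 1 h) (hs : tsupport h ⊆ K) (v : V) :
    Integrable (fun y ↦ f y * fderiv ℝ h y v) μ :=
  integrable_mul_of_tsupport_subset hU hK hKU hf
    ((hh.continuous_fderiv one_ne_zero).clm_apply continuous_const)
    ((tsupport_fderiv_apply_subset ℝ v).trans hs)

variable [FiniteDimensional ℝ V]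

lemma exists_abs_setIntegral_mul_fderiv_le (μ : Measure V) [μ.IsAddHaarMeasure] (hU : IsOpen U)
    (hK : IsCompact K) (hKU : K ⊆ U) {f w : V → ℝ} (hf : ContDiffOn ℝ 1 f U)
    (hw : ContinuousOn w U) (hw0 : ∀ y ∈ U, 0 < w y) (v : V) :
    ∃ C : ℝ, 0 ≤ C ∧ ∀ h : V → ℝ, ContDiff ℝ 1 h → tsupport h ⊆ K →
      |∫ y in U, f y * fderiv ℝ h y v ∂μ| ≤ C * ∫ y in U, w y * |h y| ∂μ := by
  have hf' : ContinuousOn (fun y ↦ fderiv ℝ f y v) U :=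
    (hf.continuousOn_fderiv_of_isOpen hU le_rfl).clm_apply continuousOn_const
  obtain ⟨C, hC⟩ := hK.exists_bound_of_continuousOn
    ((hf'.div hw fun y hy ↦ (hw0 y hy).ne').mono hKU)
  have hbound : ∀ y ∈ K, |fderiv ℝ f y v| ≤ |C| * w y := fun y hy ↦ by
    have hquot := (hC y hy).trans (le_abs_self C)
    rwa [Pi.div_apply, Real.norm_eq_abs, abs_div, abs_of_pos (hw0 y (hKU hy)),
      div_le_iff₀ (hw0 y (hKU hy))] at hquot
  refine ⟨|C|, abs_nonneg _, fun h hh hs ↦ ?_⟩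
  have hf'h : Integrable (fun y ↦ fderiv ℝ f y v * h y) μ :=
    integrable_mul_of_tsupport_subset hU hK hKU hf' hh.continuous hs
  have habs : tsupport (fun y ↦ |h y|) ⊆ K := (tsupport_comp_subset abs_zero h).trans hs
  have hwh : Integrable (fun y ↦ w y * |h y|) μ :=
    integrable_mul_of_tsupport_subset hU hK hKU hw hh.continuous.abs habs
  have hparts : ∫ y, f y * fderiv ℝ h y v ∂μ = -∫ y, fderiv ℝ f y v * h y ∂μ :=
    integral_mul_fderiv_eq_neg_fderiv_mul_of_integrable hf'h
      (integrable_mul_fderiv_of_tsupport_subset hU hK hKU hf.continuousOn hh hs v)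
      (integrable_mul_of_tsupport_subset hU hK hKU hf.continuousOn hh.continuous hs)
      (fun y hy ↦ (hf.differentiableOn one_ne_zero).differentiableAt (hU.mem_nhds (hKU (hs hy))))
      fun y _ ↦ hh.differentiable one_ne_zero y
  rw [setIntegral_mul_eq_integral_of_tsupport_subset f
      (((tsupport_fderiv_apply_subset ℝ v).trans hs).trans hKU),
    setIntegral_mul_eq_integral_of_tsupport_subset w (habs.trans hKU), hparts, abs_neg,
    ← integral_const_mul]
  refine abs_integral_le_integral_abs.trans (integral_mono hf'h.abs (hwh.const_mul _) fun y ↦ ?_)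
  simp only [abs_mul, ← mul_assoc]
  by_cases hy : y ∈ K
  · exact mul_le_mul_of_nonneg_right (hbound y hy) (abs_nonneg _)
  · simp only [image_eq_zero_of_notMem_tsupport fun hmem ↦ hy (hs hmem), abs_zero, mul_zero,
      le_refl]

end Euclidean

section ChartExtension

variable {V : Type*} [NormedAddCommGroup V] [NormedSpace ℝ V]
  {M : Type*} [TopologicalSpace M] [ChartedSpace V M]
  {W : Type*} [NormedAddCommGroup W]

/-- The expression of a function `g` on a manifold in the preferred chart at `x₀`, extended by zero
outside the target of the chart. -/
def chartExtension (x₀ : M) (g : M → W) : V → W :=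
  (extChartAt 𝓘(ℝ, V) x₀).target.indicator (g ∘ (extChartAt 𝓘(ℝ, V) x₀).symm)

lemma chartExtension_apply (x₀ : M) (g : M → W) {y : V}
    (hy : y ∈ (extChartAt 𝓘(ℝ, V) x₀).target) :
    chartExtension x₀ g y = g ((extChartAt 𝓘(ℝ, V) x₀).symm y) :=
  indicator_of_mem hy _

lemma chartExtension_extChartAt (x₀ : M) (g : M → W) {x : M}
    (hx : x ∈ (extChartAt 𝓘(ℝ, V) x₀).source) :
    chartExtension x₀ g (extChartAt 𝓘(ℝ, V) x₀ x) = g x := by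
  rw [chartExtension_apply x₀ g ((extChartAt 𝓘(ℝ, V) x₀).map_source hx),
    (extChartAt 𝓘(ℝ, V) x₀).left_inv hx]

lemma chartExtension_eventuallyEq (x₀ : M) (g : M → W) {y : V}
    (hy : y ∈ (extChartAt 𝓘(ℝ, V) x₀).target) :
    chartExtension x₀ g =ᶠ[𝓝 y] g ∘ (extChartAt 𝓘(ℝ, V) x₀).symm :=
  eventually_of_mem ((isOpen_extChartAt_target x₀).mem_nhds hy) fun _ hz ↦ indicator_of_mem hz _

lemma tsupport_chartExtension_subset (x₀ : M) {g : M → W} {K : Set M} (hK : IsCompact K)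
    (hKs : K ⊆ (extChartAt 𝓘(ℝ, V) x₀).source) (hg : tsupport g ⊆ K) :
    tsupport (chartExtension x₀ g) ⊆ extChartAt 𝓘(ℝ, V) x₀ '' K := by
  refine closure_minimal (fun y hy ↦ ?_)
    (hK.image_of_continuousOn ((continuousOn_extChartAt x₀).mono hKs)).isClosed
  obtain ⟨hyt, hyg⟩ := support_indicator.subset hy
  exact ⟨_, hg (subset_tsupport _ hyg), (extChartAt 𝓘(ℝ, V) x₀).right_inv hyt⟩

variable [NormedSpace ℝ W]

lemma mvfderiv_eq_zero_of_notMem_tsupport {g : M → W} {x : M} (hx : x ∉ tsupport g) :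
    mvfderiv 𝓘(ℝ, V) g x = 0 := by
  have hzero : g =ᶠ[𝓝 x] fun _ ↦ (0 : W) := notMem_tsupport_iff_eventuallyEq.1 hx
  ext v
  simp only [mvfderiv, hzero.mfderiv_eq, mfderiv_const]
  exact map_zero (NormedSpace.fromTangentSpace (𝕜 := ℝ) (g x))

variable [IsManifold 𝓘(ℝ, V) ∞ M]

lemma contDiffOn_comp_extChartAt_symm (x₀ : M) {g : M → W}
    (hg : ContMDiff 𝓘(ℝ, V) 𝓘(ℝ, W) ∞ g) :
    ContDiffOn ℝ ∞ (g ∘ (extChartAt 𝓘(ℝ, V) x₀).symm) (extChartAt 𝓘(ℝ, V) x₀).target :=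
  contMDiffOn_iff_contDiffOn.1 (hg.comp_contMDiffOn (contMDiffOn_extChartAt_symm x₀))

lemma contDiff_chartExtension (x₀ : M) {g : M → W} (hg : ContMDiff 𝓘(ℝ, V) 𝓘(ℝ, W) ∞ g)
    {K : Set M} (hK : IsCompact K) (hKs : K ⊆ (extChartAt 𝓘(ℝ, V) x₀).source)
    (hgK : tsupport g ⊆ K) : ContDiff ℝ ∞ (chartExtension (V := V) x₀ g) := by
  refine contMDiff_iff_contDiff.1 (contMDiff_of_tsupport fun y hy ↦ ?_)
  obtain ⟨x, hx, rfl⟩ := tsupport_chartExtension_subset x₀ hK hKs hgK hy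
  have hxt := (extChartAt 𝓘(ℝ, V) x₀).map_source (hKs hx)
  exact (((contDiffOn_comp_extChartAt_symm x₀ hg).contDiffAt
    ((isOpen_extChartAt_target x₀).mem_nhds hxt)).congr_of_eventuallyEq
      (chartExtension_eventuallyEq x₀ g hxt)).contMDiffAt

lemma mvfderiv_apply_eq_fderiv_chartExtension (x₀ : M) {g : M → W} {x : M}
    (hg : MDifferentiableAt 𝓘(ℝ, V) 𝓘(ℝ, W) g x) (hx : x ∈ (extChartAt 𝓘(ℝ, V) x₀).source)
    (v : TangentSpace 𝓘(ℝ, V) x) :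
    mvfderiv 𝓘(ℝ, V) g x v = fderiv ℝ (chartExtension x₀ g) (extChartAt 𝓘(ℝ, V) x₀ x)
      (mfderiv 𝓘(ℝ, V) 𝓘(ℝ, V) (extChartAt 𝓘(ℝ, V) x₀) x v) := by
  set φ := extChartAt 𝓘(ℝ, V) x₀
  have hφ : MDifferentiableAt 𝓘(ℝ, V) 𝓘(ℝ, V) φ x :=
    mdifferentiableAt_extChartAt (by simpa [φ] using hx)
  have hext : MDifferentiableAt 𝓘(ℝ, V) 𝓘(ℝ, W) (chartExtension x₀ g) (φ x) :=
    MDifferentiableAt.congr_of_eventuallyEq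
      (((φ.left_inv hx).symm ▸ hg : MDifferentiableAt 𝓘(ℝ, V) 𝓘(ℝ, W) g (φ.symm (φ x))).comp _
        (mdifferentiableAt_extChartAt_symm x₀ (φ.map_source hx)))
      (chartExtension_eventuallyEq x₀ g (φ.map_source hx))
  have hfactor : g =ᶠ[𝓝 x] chartExtension x₀ g ∘ φ :=
    eventually_of_mem ((isOpen_extChartAt_source x₀).mem_nhds hx)
      fun z hz ↦ (chartExtension_extChartAt x₀ g hz).symm
  have hchain := mfderiv_comp x hext hφ
  rw [← hfactor.mfderiv_eq, mfderiv_eq_fderiv] at hchain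
  exact congrArg (fun L : V →L[ℝ] W ↦ L v) hchain

end ChartExtension

section Cutoff

variable {V : Type*} [NormedAddCommGroup V] [NormedSpace ℝ V] [FiniteDimensional ℝ V]
  {M : Type*} [TopologicalSpace M] [ChartedSpace V M] [IsManifold 𝓘(ℝ, V) ∞ M] [T2Space M]

lemma exists_contMDiffMap_eventuallyEq_one_tsupport_subset [SigmaCompactSpace M] {K U : Set M}
    (hK : IsClosed K) (hU : IsOpen U) (hKU : K ⊆ U) :
    ∃ χ : C^∞⟮𝓘(ℝ, V), M; ℝ⟯, χ =ᶠ[𝓝ˢ K] 1 ∧ tsupport χ ⊆ U := by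
  have : LocallyCompactSpace M := ChartedSpace.locallyCompactSpace V M
  obtain ⟨χ, hzero, hone, -⟩ := exists_contMDiffMap_zero_one_nhds_of_isClosed (n := ⊤) 𝓘(ℝ, V)
    hU.isClosed_compl hK (disjoint_compl_left_iff_subset.2 hKU)
  refine ⟨χ, hone, fun x hx ↦ ?_⟩
  by_contra hxU
  exact notMem_tsupport_iff_eventuallyEq.2 (hzero.filter_mono (nhds_le_nhdsSet hxU)) hx

lemma exists_finite_partitionOfUnity [CompactSpace M] (U : M → Set M) (hU : ∀ x, IsOpen (U x))
    (hxU : ∀ x, x ∈ U x) :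
    ∃ (t : Finset M) (ρ : t → C^∞⟮𝓘(ℝ, V), M; ℝ⟯), (∀ x, ∑ i, ρ i x = 1) ∧
      (∀ i x, |ρ i x| ≤ 1) ∧ ∀ i, tsupport (ρ i) ⊆ U i := by
  obtain ⟨t, ht⟩ := isCompact_univ.elim_finite_subcover U hU fun x _ ↦ mem_iUnion.2 ⟨x, hxU x⟩
  obtain ⟨ρ, hρ⟩ := SmoothPartitionOfUnity.exists_isSubordinate 𝓘(ℝ, V) isClosed_univ
    (fun i : t ↦ U i) (fun i ↦ hU i) fun x hx ↦ by simpa using ht hx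
  refine ⟨t, fun i ↦ ρ i, fun x ↦ ?_, fun i x ↦ ?_, hρ⟩
  · rw [← finsum_eq_sum_of_fintype, ρ.sum_eq_one (mem_univ x)]
  · rw [abs_of_nonneg (ρ.nonneg i x)]
    exact ρ.le_one i x

end Cutoff

section Differential

variable {V : Type*} [NormedAddCommGroup V] [NormedSpace ℝ V]
  {M : Type*} [TopologicalSpace M] [ChartedSpace V M]
  {W : Type*} [NormedAddCommGroup W] [NormedSpace ℝ W]

lemma mvfderiv_finsetSum {ι : Type*} (t : Finset ι) {f : ι → M → W} {x : M}
    (hf : ∀ i ∈ t, MDifferentiableAt 𝓘(ℝ, V) 𝓘(ℝ, W) (f i) x) :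
    mvfderiv 𝓘(ℝ, V) (∑ i ∈ t, f i) x = ∑ i ∈ t, mvfderiv 𝓘(ℝ, V) (f i) x := by
  classical
  induction t using Finset.induction_on with
  | empty => simp only [Finset.sum_empty, mvfderiv_zero]
  | insert i t hi ih =>
    have ht := fun j hj ↦ hf j (Finset.mem_insert_of_mem hj)
    have hsum : MDifferentiableAt 𝓘(ℝ, V) 𝓘(ℝ, W) (∑ j ∈ t, f j) x :=
      Finset.sum_induction f (MDifferentiableAt 𝓘(ℝ, V) 𝓘(ℝ, W) · x)
        (fun _ _ ↦ MDifferentiableAt.add) mdifferentiableAt_const ht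
    rw [Finset.sum_insert hi, Finset.sum_insert hi, ← ih ht,
      mvfderiv_add (hf i (Finset.mem_insert_self i t)) hsum]

end Differential

section Coordinates

variable {n : ℕ} {X : Type*} [TopologicalSpace X] [ChartedSpace (EuclideanSpace ℝ (Fin n)) X]
  [IsManifold (𝓡 n) ∞ X]

lemma mvfderiv_apply_of_eventuallyEq_coordinate (x₀ : X) {x : X}
    (hx : x ∈ (extChartAt (𝓡 n) x₀).source) {y : X → ℝ} {i : Fin n}
    (hy : y =ᶠ[𝓝 x] fun z ↦ extChartAt (𝓡 n) x₀ z i) (v : TangentSpace (𝓡 n) x) :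
    mvfderiv (𝓡 n) y x v = EuclideanSpace.proj (𝕜 := ℝ) i
      (mfderiv (𝓡 n) 𝓘(ℝ, EuclideanSpace ℝ (Fin n)) (extChartAt (𝓡 n) x₀) x v) := by
  have hφ : MDifferentiableAt (𝓡 n) 𝓘(ℝ, EuclideanSpace ℝ (Fin n)) (extChartAt (𝓡 n) x₀) x :=
    mdifferentiableAt_extChartAt (by simpa using hx)
  have hproj : HasMFDerivAt 𝓘(ℝ, EuclideanSpace ℝ (Fin n)) 𝓘(ℝ, ℝ)
      (EuclideanSpace.proj (𝕜 := ℝ) i) (extChartAt (𝓡 n) x₀ x)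
      (EuclideanSpace.proj (𝕜 := ℝ) i) :=
    (EuclideanSpace.proj (𝕜 := ℝ) i).hasMFDerivAt
  have hchain := (hproj.comp x hφ.hasMFDerivAt).congr_of_eventuallyEq hy
  exact congrArg (fun T : EuclideanSpace ℝ (Fin n) →L[ℝ] ℝ ↦ T v) hchain.mfderiv

lemma mvfderiv_eq_sum_smul_mvfderiv_coordinate (x₀ : X) {x : X}
    (hx : x ∈ (extChartAt (𝓡 n) x₀).source) {g : X → ℝ}
    (hg : MDifferentiableAt (𝓡 n) 𝓘(ℝ, ℝ) g x) {y : Fin n → X → ℝ}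
    (hy : ∀ i, y i =ᶠ[𝓝 x] fun z ↦ extChartAt (𝓡 n) x₀ z i) :
    mvfderiv (𝓡 n) g x = ∑ i, fderiv ℝ (chartExtension x₀ g) (extChartAt (𝓡 n) x₀ x)
      (EuclideanSpace.single i 1) • mvfderiv (𝓡 n) (y i) x := by
  ext v
  let u : EuclideanSpace ℝ (Fin n) :=
    mfderiv (𝓡 n) 𝓘(ℝ, EuclideanSpace ℝ (Fin n)) (extChartAt (𝓡 n) x₀) x v
  have hu : u = ∑ i, u i • EuclideanSpace.single i (1 : ℝ) := by
    simpa using ((EuclideanSpace.basisFun (Fin n) ℝ).sum_repr u).symm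
  calc mvfderiv (𝓡 n) g x v
      = fderiv ℝ (chartExtension x₀ g) (extChartAt (𝓡 n) x₀ x) u :=
        mvfderiv_apply_eq_fderiv_chartExtension x₀ hg hx v
    _ = ∑ i, fderiv ℝ (chartExtension x₀ g) (extChartAt (𝓡 n) x₀ x)
          (EuclideanSpace.single i 1) * u i := by
        conv_lhs => rw [hu]
        simp only [map_sum, map_smul, smul_eq_mul, mul_comm]
    _ = _ := by
        rw [_root_.sum_apply]
        exact Finset.sum_congr rfl fun i _ ↦ congrArg _
          (mvfderiv_apply_of_eventuallyEq_coordinate x₀ hx (hy i) v).symm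

lemma exists_contMDiffMap_eventuallyEq_coordinate [T2Space X] [SigmaCompactSpace X] (x₀ : X)
    {K : Set X} (hK : IsClosed K) (hKs : K ⊆ (extChartAt (𝓡 n) x₀).source) (i : Fin n) :
    ∃ y : C^∞⟮𝓡 n, X; ℝ⟯, y =ᶠ[𝓝ˢ K] fun z ↦ extChartAt (𝓡 n) x₀ z i := by
  obtain ⟨χ, hone, hs⟩ := exists_contMDiffMap_eventuallyEq_one_tsupport_subset
    (V := EuclideanSpace ℝ (Fin n)) hK (isOpen_extChartAt_source x₀) hKs
  have hsmooth : ContMDiff (𝓡 n) 𝓘(ℝ, ℝ) ∞ fun z ↦ χ z * extChartAt (𝓡 n) x₀ z i := by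
    refine contMDiff_of_tsupport fun z hz ↦ χ.contMDiff.contMDiffAt.mul ?_
    exact (EuclideanSpace.proj (𝕜 := ℝ) i).contDiff.contMDiff.contMDiffAt.comp z
      (contMDiffAt_extChartAt' (by simpa using hs (tsupport_mul_subset_left hz)))
  refine ⟨⟨_, hsmooth⟩, hone.mono fun z hz ↦ ?_⟩
  simp only [ContMDiffMap.coeFn_mk, hz, Pi.one_apply, one_mul]

end Coordinates

section Divergence

variable {n : ℕ} {X : Type*} [TopologicalSpace X] [ChartedSpace (EuclideanSpace ℝ (Fin n)) X]
  [IsManifold (𝓡 n) ∞ X]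

/-- A smooth vector field, encoded as the family of its evaluation functionals on the cotangent
spaces; smoothness is tested on the differentials of smooth functions. -/
def IsSmoothField (L : ∀ x : X, (TangentSpace (𝓡 n) x →L[ℝ] ℝ) →ₗ[ℝ] ℝ) : Prop :=
  ∀ f : C^∞⟮𝓡 n, X; ℝ⟯, ContMDiff (𝓡 n) 𝓘(ℝ, ℝ) ∞ fun x ↦ L x (mvfderiv (𝓡 n) f x)

variable (L : ∀ x : X, (TangentSpace (𝓡 n) x →L[ℝ] ℝ) →ₗ[ℝ] ℝ) (x₀ : X) {K : Set X}

lemma field_apply_mvfderiv_eq_sum (hK : IsCompact K) (hKs : K ⊆ (extChartAt (𝓡 n) x₀).source)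
    {y : Fin n → X → ℝ} (hy : ∀ i, y i =ᶠ[𝓝ˢ K] fun z ↦ extChartAt (𝓡 n) x₀ z i)
    {g : X → ℝ} (hg : MDifferentiable (𝓡 n) 𝓘(ℝ, ℝ) g) (hgK : tsupport g ⊆ K)
    {z : EuclideanSpace ℝ (Fin n)} (hz : z ∈ (extChartAt (𝓡 n) x₀).target) :
    L ((extChartAt (𝓡 n) x₀).symm z) (mvfderiv (𝓡 n) g ((extChartAt (𝓡 n) x₀).symm z)) =
      ∑ i, L ((extChartAt (𝓡 n) x₀).symm z)
          (mvfderiv (𝓡 n) (y i) ((extChartAt (𝓡 n) x₀).symm z)) *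
        fderiv ℝ (chartExtension x₀ g) z (EuclideanSpace.single i 1) := by
  set φ := extChartAt (𝓡 n) x₀
  by_cases hzK : φ.symm z ∈ K
  · rw [mvfderiv_eq_sum_smul_mvfderiv_coordinate x₀ (φ.map_target hz) (hg _)
      fun i ↦ (hy i).filter_mono (nhds_le_nhdsSet hzK), map_sum]
    refine Finset.sum_congr rfl fun i _ ↦ ?_
    rw [map_smul, smul_eq_mul, mul_comm, φ.right_inv hz]
  · have hzt : z ∉ tsupport (chartExtension x₀ g) := fun hmem ↦ by
      obtain ⟨x, hx, rfl⟩ := tsupport_chartExtension_subset x₀ hK hKs hgK hmem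
      exact hzK (by rwa [φ.left_inv (hKs hx)])
    rw [mvfderiv_eq_zero_of_notMem_tsupport fun h ↦ hzK (hgK h), map_zero,
      fderiv_of_notMem_tsupport ℝ hzt]
    simp only [_root_.zero_apply, mul_zero, Finset.sum_const_zero]

variable [RiemannianBundle (fun x : X ↦ TangentSpace (𝓡 n) x)]
  [IsContMDiffRiemannianBundle (𝓡 n) ∞ (EuclideanSpace ℝ (Fin n))
      (fun x : X ↦ TangentSpace (𝓡 n) x)]

variable {L}

lemma IsSmoothField.contDiffOn_volumeDensity_mul (hL : IsSmoothField L) (f : C^∞⟮𝓡 n, X; ℝ⟯) :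
    ContDiffOn ℝ ∞ (fun z ↦ volumeDensity x₀ z * L ((extChartAt (𝓡 n) x₀).symm z)
      (mvfderiv (𝓡 n) f ((extChartAt (𝓡 n) x₀).symm z))) (extChartAt (𝓡 n) x₀).target :=
  (contDiffOn_volumeDensity x₀).mul (contDiffOn_comp_extChartAt_symm x₀ (hL f))

variable [MeasurableSpace X] [BorelSpace X]

lemma integrable_riemannianVolume_of_continuous [CompactSpace X] {G : Type*}
    [NormedAddCommGroup G] {f : X → G} (hf : Continuous f) :
    Integrable f (riemannianVolume n X) :=
  hf.integrable_of_hasCompactSupport (.of_compactSpace f)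

lemma integral_eq_setIntegral_target {g : X → ℝ}
    (hg : AEStronglyMeasurable g (riemannianVolume n X))
    (hgs : Function.support g ⊆ (extChartAt (𝓡 n) x₀).source) :
    ∫ x, g x ∂(riemannianVolume n X) =
      ∫ z in (extChartAt (𝓡 n) x₀).target,
        volumeDensity x₀ z * g ((extChartAt (𝓡 n) x₀).symm z) := by
  rw [← setIntegral_eq_integral_of_forall_compl_eq_zero fun x hx ↦
    Function.notMem_support.1 fun h ↦ hx (hgs h), setIntegral_source_riemannianVolume x₀ hg]
  rfl

lemma IsSmoothField.integral_apply_mvfderiv_eq_sum (hL : IsSmoothField L) (hK : IsCompact K)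
    (hKs : K ⊆ (extChartAt (𝓡 n) x₀).source) {y : Fin n → C^∞⟮𝓡 n, X; ℝ⟯}
    (hy : ∀ i, y i =ᶠ[𝓝ˢ K] fun z ↦ extChartAt (𝓡 n) x₀ z i) {g : C^∞⟮𝓡 n, X; ℝ⟯}
    (hgK : tsupport g ⊆ K) :
    ∫ x, L x (mvfderiv (𝓡 n) g x) ∂(riemannianVolume n X) =
      ∑ i, ∫ z in (extChartAt (𝓡 n) x₀).target,
        volumeDensity x₀ z * L ((extChartAt (𝓡 n) x₀).symm z)
            (mvfderiv (𝓡 n) (y i) ((extChartAt (𝓡 n) x₀).symm z)) *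
          fderiv ℝ (chartExtension x₀ g) z (EuclideanSpace.single i 1) := by
  have hopen : IsOpen (extChartAt (𝓡 n) x₀).target := isOpen_extChartAt_target x₀
  have hsupp : Function.support (fun x ↦ L x (mvfderiv (𝓡 n) g x)) ⊆
      (extChartAt (𝓡 n) x₀).source := fun x hx ↦ hKs <| hgK <| by
    by_contra hxg
    exact hx (by simp only [mvfderiv_eq_zero_of_notMem_tsupport hxg, map_zero])
  have himage : extChartAt (𝓡 n) x₀ '' K ⊆ (extChartAt (𝓡 n) x₀).target :=
    (image_mono hKs).trans (extChartAt (𝓡 n) x₀).image_source_eq_target.subset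
  rw [integral_eq_setIntegral_target x₀ (hL g).continuous.aestronglyMeasurable hsupp,
    ← integral_finsetSum _ fun i _ ↦ (integrable_mul_fderiv_of_tsupport_subset hopen
      (hK.image_of_continuousOn ((continuousOn_extChartAt x₀).mono hKs)) himage
      (hL.contDiffOn_volumeDensity_mul x₀ (y i)).continuousOn
      ((contDiff_chartExtension x₀ g.contMDiff hK hKs hgK).of_le (by simp))
      (tsupport_chartExtension_subset x₀ hK hKs hgK) _).integrableOn]
  refine setIntegral_congr_fun hopen.measurableSet fun z hz ↦ ?_
  simp only [field_apply_mvfderiv_eq_sum L x₀ hK hKs hy (g.contMDiff.mdifferentiable (by simp))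
    hgK hz, Finset.mul_sum, mul_assoc]

lemma IsSmoothField.exists_abs_integral_le_of_tsupport_subset [T2Space X] [SigmaCompactSpace X]
    (hL : IsSmoothField L) (hK : IsCompact K) (hKs : K ⊆ (extChartAt (𝓡 n) x₀).source) :
    ∃ C : ℝ, 0 ≤ C ∧ ∀ g : C^∞⟮𝓡 n, X; ℝ⟯, tsupport g ⊆ K →
      |∫ x, L x (mvfderiv (𝓡 n) g x) ∂(riemannianVolume n X)| ≤
        C * ∫ x, |g x| ∂(riemannianVolume n X) := by
  choose y hy using exists_contMDiffMap_eventuallyEq_coordinate x₀ hK.isClosed hKs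
  have hopen : IsOpen (extChartAt (𝓡 n) x₀).target := isOpen_extChartAt_target x₀
  choose C hC0 hC using fun i ↦ exists_abs_setIntegral_mul_fderiv_le volume hopen
    (hK.image_of_continuousOn ((continuousOn_extChartAt x₀).mono hKs))
    ((image_mono hKs).trans (extChartAt (𝓡 n) x₀).image_source_eq_target.subset)
    ((hL.contDiffOn_volumeDensity_mul x₀ (y i)).of_le (by simp))
    (contDiffOn_volumeDensity x₀).continuousOn (fun z hz ↦ volumeDensity_pos x₀ hz)
    (EuclideanSpace.single i (1 : ℝ))
  refine ⟨∑ i, C i, Finset.sum_nonneg fun i _ ↦ hC0 i, fun g hgK ↦ ?_⟩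
  have habs : ∫ x, |g x| ∂(riemannianVolume n X) =
      ∫ z in (extChartAt (𝓡 n) x₀).target, volumeDensity x₀ z * |chartExtension x₀ g z| := by
    rw [integral_eq_setIntegral_target x₀ g.contMDiff.continuous.abs.aestronglyMeasurable
      fun x hx ↦ hKs (hgK (subset_tsupport _ (abs_ne_zero.1 hx)))]
    refine setIntegral_congr_fun hopen.measurableSet fun z hz ↦ ?_
    simp only [chartExtension_apply x₀ _ hz]
  rw [hL.integral_apply_mvfderiv_eq_sum x₀ hK hKs hy hgK, habs, Finset.sum_mul]
  exact (Finset.abs_sum_le_sum_abs _ _).trans (Finset.sum_le_sum fun i _ ↦ hC i _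
    ((contDiff_chartExtension x₀ g.contMDiff hK hKs hgK).of_le (by simp))
    (tsupport_chartExtension_subset x₀ hK hKs hgK))

lemma IsSmoothField.exists_abs_integral_le [T2Space X] [CompactSpace X] (hL : IsSmoothField L) :
    ∃ C : ℝ, 0 ≤ C ∧ ∀ f : C^∞⟮𝓡 n, X; ℝ⟯,
      |∫ x, L x (mvfderiv (𝓡 n) f x) ∂(riemannianVolume n X)| ≤
        C * ∫ x, |f x| ∂(riemannianVolume n X) := by
  obtain ⟨t, ρ, hsum, hρ1, hs⟩ := exists_finite_partitionOfUnity (V := EuclideanSpace ℝ (Fin n))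
    (fun x : X ↦ (extChartAt (𝓡 n) x).source) (fun x ↦ isOpen_extChartAt_source x)
    fun x ↦ mem_extChartAt_source x
  choose C hC0 hC using fun i : t ↦ hL.exists_abs_integral_le_of_tsupport_subset
    (i : X) (isClosed_tsupport (ρ i)).isCompact (hs i)
  refine ⟨∑ i, C i, Finset.sum_nonneg fun i _ ↦ hC0 i, fun f ↦ ?_⟩
  have hpieces : ∀ x, L x (mvfderiv (𝓡 n) f x) =
      ∑ i, L x (mvfderiv (𝓡 n) (ρ i * f : C^∞⟮𝓡 n, X; ℝ⟯) x) := fun x ↦ by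
    have hf : (f : X → ℝ) = ∑ i, ((ρ i * f : C^∞⟮𝓡 n, X; ℝ⟯) : X → ℝ) := by
      ext z
      simp only [Finset.sum_apply, ContMDiffMap.coe_mul, Pi.mul_apply, ← Finset.sum_mul, hsum,
        one_mul]
    rw [← map_sum, ← mvfderiv_finsetSum _ fun i _ ↦
      (ρ i * f : C^∞⟮𝓡 n, X; ℝ⟯).contMDiff.mdifferentiableAt (by simp), ← hf]
  have hpiece : ∀ i, ∫ x, |(ρ i * f : C^∞⟮𝓡 n, X; ℝ⟯) x| ∂(riemannianVolume n X) ≤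
      ∫ x, |f x| ∂(riemannianVolume n X) := fun i ↦ by
    refine integral_mono
      (integrable_riemannianVolume_of_continuous (ρ i * f).contMDiff.continuous.abs)
      (integrable_riemannianVolume_of_continuous f.contMDiff.continuous.abs) fun x ↦ ?_
    simp only [ContMDiffMap.coe_mul, Pi.mul_apply, abs_mul]
    exact mul_le_of_le_one_left (abs_nonneg _) (hρ1 i x)
  simp only [hpieces]
  rw [integral_finsetSum _
      fun i _ ↦ integrable_riemannianVolume_of_continuous (hL (ρ i * f)).continuous,
    Finset.sum_mul]
  exact (Finset.abs_sum_le_sum_abs _ _).trans (Finset.sum_le_sum fun i _ ↦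
    (hC i (ρ i * f) (tsupport_mul_subset_left)).trans
      (mul_le_mul_of_nonneg_left (hpiece i) (hC0 i)))

end Divergence

section BoundedBelow

lemma eventually_mul_norm_le_of_ker_eq_bot {V W : Type*} [NormedAddCommGroup V] [NormedSpace ℝ V]
    [FiniteDimensional ℝ V] [NormedAddCommGroup W] [NormedSpace ℝ W] {T : V →L[ℝ] W}
    (hT : LinearMap.ker T.toLinearMap = ⊥) :
    ∃ c : ℝ, 0 < c ∧ ∀ᶠ S in 𝓝 T, ∀ v, c * ‖v‖ ≤ ‖S v‖ := by
  obtain ⟨K, hK0, hK⟩ := LinearMap.exists_antilipschitzWith _ hT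
  have hKpos : 0 < (K : ℝ)⁻¹ := inv_pos.2 (NNReal.coe_pos.2 hK0)
  have hnear : ∀ᶠ S in 𝓝 T, ‖T - S‖ < (K : ℝ)⁻¹ / 2 := by
    filter_upwards [Metric.ball_mem_nhds T (half_pos hKpos)] with S hS
    rwa [mem_ball_iff_norm'] at hS
  refine ⟨(K : ℝ)⁻¹ / 2, half_pos hKpos, hnear.mono fun S hS v ↦ ?_⟩
  have hTv : (K : ℝ)⁻¹ * ‖v‖ ≤ ‖T v‖ := by
    rw [inv_mul_le_iff₀ (NNReal.coe_pos.2 hK0)]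
    simpa only [dist_zero_right, map_zero, ContinuousLinearMap.coe_coe] using hK.le_mul_dist v 0
  have hdiff : ‖T v‖ ≤ ‖S v‖ + (K : ℝ)⁻¹ / 2 * ‖v‖ :=
    (norm_le_norm_add_norm_sub' (T v) (S v)).trans
      (add_le_add_right ((T - S).le_of_opNorm_le hS.le v) _)
  linarith

variable {B : Type*} [TopologicalSpace B]
  {VE : Type*} [NormedAddCommGroup VE] [NormedSpace ℝ VE]
  {E : B → Type*} [TopologicalSpace (TotalSpace VE E)] [∀ x, NormedAddCommGroup (E x)]
  [∀ x, InnerProductSpace ℝ (E x)] [FiberBundle VE E] [VectorBundle ℝ VE E]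
  {VF : Type*} [NormedAddCommGroup VF] [NormedSpace ℝ VF]
  {F : B → Type*} [TopologicalSpace (TotalSpace VF F)] [∀ x, NormedAddCommGroup (F x)]
  [∀ x, InnerProductSpace ℝ (F x)] [FiberBundle VF F] [VectorBundle ℝ VF F]
  {A : ∀ x, E x →L[ℝ] F x}

lemma ker_inCoordinates_eq_bot {x₀ : B} (hker : LinearMap.ker (A x₀).toLinearMap = ⊥) :
    LinearMap.ker (ContinuousLinearMap.inCoordinates VE E VF F x₀ x₀ x₀ x₀ (A x₀)).toLinearMap =
      ⊥ := by
  have hE := mem_baseSet_trivializationAt VE E x₀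
  have hF := mem_baseSet_trivializationAt VF F x₀
  rw [ContinuousLinearMap.inCoordinates_eq hE hF, LinearMap.ker_eq_bot]
  exact ((trivializationAt VF F x₀).continuousLinearEquivAt ℝ x₀ hF).injective.comp
    ((LinearMap.ker_eq_bot.1 hker).comp
      ((trivializationAt VE E x₀).continuousLinearEquivAt ℝ x₀ hE).symm.injective)

variable [FiniteDimensional ℝ VE] [IsContinuousRiemannianBundle VE E]
  [IsContinuousRiemannianBundle VF F]

lemma eventually_mul_norm_fiber_le {x₀ : B}
    (hA : ContinuousAt (fun x ↦ (⟨x, A x⟩ : TotalSpace (VE →L[ℝ] VF) fun x ↦ E x →L[ℝ] F x)) x₀)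
    (hker : LinearMap.ker (A x₀).toLinearMap = ⊥) :
    ∃ κ : ℝ, 0 < κ ∧ ∀ᶠ x in 𝓝 x₀, ∀ v : E x, κ * ‖v‖ ≤ ‖A x v‖ := by
  obtain ⟨c, hc0, hc⟩ :=
    eventually_mul_norm_le_of_ker_eq_bot (ker_inCoordinates_eq_bot (VE := VE) (VF := VF) hker)
  obtain ⟨CE, hCE0, hCE⟩ := eventually_norm_symmL_trivializationAt_lt VE E x₀
  obtain ⟨CF, hCF0, hCF⟩ := eventually_norm_trivializationAt_lt VF F x₀
  have hcont := ((continuousAt_hom_bundle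
    (f := fun x ↦ (⟨x, A x⟩ : TotalSpace (VE →L[ℝ] VF) fun x ↦ E x →L[ℝ] F x))).1 hA).2
  refine ⟨c / (CE * CF), by positivity, ?_⟩
  filter_upwards [hcont.eventually hc, hCE, hCF,
    (trivializationAt VE E x₀).open_baseSet.mem_nhds (mem_baseSet_trivializationAt VE E x₀)]
    with x hcx hCEx hCFx hxE v
  let w := (trivializationAt VE E x₀).continuousLinearMapAt ℝ x v
  have hw : (trivializationAt VE E x₀).symmL ℝ x w = v :=
    (trivializationAt VE E x₀).symmL_continuousLinearMapAt hxE v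
  have hv : ‖v‖ ≤ CE * ‖w‖ := by
    conv_lhs => rw [← hw]
    exact ContinuousLinearMap.le_of_opNorm_le _ hCEx.le w
  have hAv : c * ‖w‖ ≤ CF * ‖A x v‖ := by
    refine (hcx w).trans ?_
    conv_rhs => rw [← hw]
    exact ContinuousLinearMap.le_of_opNorm_le _ hCFx.le _
  rw [div_mul_eq_mul_div, div_le_iff₀ (by positivity)]
  calc c * ‖v‖ ≤ CE * (c * ‖w‖) := by nlinarith
    _ ≤ CE * (CF * ‖A x v‖) := by gcongr
    _ = ‖A x v‖ * (CE * CF) := by ring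

lemma exists_mul_norm_fiber_le {K : Set B} (hK : IsCompact K)
    (hA : Continuous fun x ↦ (⟨x, A x⟩ : TotalSpace (VE →L[ℝ] VF) fun x ↦ E x →L[ℝ] F x))
    (hker : ∀ x ∈ K, LinearMap.ker (A x).toLinearMap = ⊥) :
    ∃ κ : ℝ, 0 < κ ∧ ∀ x ∈ K, ∀ v : E x, κ * ‖v‖ ≤ ‖A x v‖ := by
  refine hK.induction_on (p := fun S ↦ ∃ κ : ℝ, 0 < κ ∧ ∀ x ∈ S, ∀ v : E x, κ * ‖v‖ ≤ ‖A x v‖)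
    ⟨1, one_pos, fun x hx ↦ hx.elim⟩
    (fun S T hST ⟨κ, hκ0, hκ⟩ ↦ ⟨κ, hκ0, fun x hx ↦ hκ x (hST hx)⟩) ?_ fun x hx ↦ ?_
  · rintro S T ⟨κ, hκ0, hκ⟩ ⟨κ', hκ0', hκ'⟩
    refine ⟨min κ κ', lt_min hκ0 hκ0', ?_⟩
    rintro x (hx | hx) v
    · exact (mul_le_mul_of_nonneg_right (min_le_left _ _) (norm_nonneg _)).trans (hκ x hx v)
    · exact (mul_le_mul_of_nonneg_right (min_le_right _ _) (norm_nonneg _)).trans (hκ' x hx v)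
  · obtain ⟨κ, hκ0, hκ⟩ := eventually_mul_norm_fiber_le hA.continuousAt (hker x hx)
    exact ⟨_, mem_nhdsWithin_of_mem_nhds hκ, κ, hκ0, fun _ ↦ id⟩

end BoundedBelow

section GeneratingSections

universe u

variable {n : ℕ} {X : Type u} [TopologicalSpace X] [ChartedSpace (EuclideanSpace ℝ (Fin n)) X]
  {VE : Type*} [NormedAddCommGroup VE] [NormedSpace ℝ VE]
  {E : X → Type*} [TopologicalSpace (TotalSpace VE E)] [∀ x, NormedAddCommGroup (E x)]
  [∀ x, InnerProductSpace ℝ (E x)] [FiberBundle VE E] [VectorBundle ℝ VE E]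

lemma isContinuousRiemannianBundle_of_contMDiff
    (h : IsContMDiffRiemannianBundle (𝓡 n) ∞ VE E) : IsContinuousRiemannianBundle VE E := by
  obtain ⟨g, hg, hinner⟩ := h.exists_contMDiff
  exact ⟨g, hg.continuous, hinner⟩

lemma sum_section_apply {ι : Type*} (t : Finset ι) (ξ : ι → Cₛ^∞⟮𝓡 n; VE, E⟯) (x : X) :
    (∑ i ∈ t, ξ i) x = ∑ i ∈ t, ξ i x := by
  rw [← ContMDiffSection.coeAddHom_apply, map_sum, Finset.sum_apply]
  rfl

lemma sum_smulSection_apply {ι : Type*} (t : Finset ι) (f : ι → C^∞⟮𝓡 n, X; ℝ⟯)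
    (ξ : ι → Cₛ^∞⟮𝓡 n; VE, E⟯) (x : X) :
    (∑ i ∈ t, smulSection (f i) (ξ i)) x = ∑ i ∈ t, f i x • ξ i x :=
  sum_section_apply t _ x

variable [FiniteDimensional ℝ VE] [ContMDiffVectorBundle ∞ VE E (𝓡 n)] {κ : Type*}
  (b : Module.Basis κ ℝ VE) {x₀ : X}

lemma abs_localFrameCoeff_le {x : X} (hx : x ∈ (trivializationAt VE E x₀).baseSet) (a : κ)
    (ξ : ∀ x, E x) :
    |(trivializationAt VE E x₀).localFrameCoeff (𝓡 n) b a x (ξ x)| ≤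
      ‖LinearMap.toContinuousLinearMap (b.coord a)‖ *
        (‖(trivializationAt VE E x₀).continuousLinearMapAt ℝ x‖ * ‖ξ x‖) := by
  have hcoeff : (trivializationAt VE E x₀).localFrameCoeff (𝓡 n) b a x (ξ x) =
      LinearMap.toContinuousLinearMap (b.coord a)
        ((trivializationAt VE E x₀).continuousLinearMapAt ℝ x (ξ x)) := by
    rw [Trivialization.localFrameCoeff_eq_coeff _ hx]
    simp only [LinearMap.coe_toContinuousLinearMap', Module.Basis.coord_apply,
      Trivialization.continuousLinearMapAt_apply, hx, Trivialization.linearMapAt_apply, if_true]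
  rw [hcoeff, ← Real.norm_eq_abs]
  exact ContinuousLinearMap.le_opNorm_of_le _ (ContinuousLinearMap.le_opNorm _ _)

/-- The local frame of the trivialization at `x₀` given by the basis `b`, cut off by `χ` to global
smooth sections. -/
def cutoffFrame (χ : C^∞⟮𝓡 n, X; ℝ⟯) (hχ : tsupport χ ⊆ (trivializationAt VE E x₀).baseSet)
    (a : κ) : Cₛ^∞⟮𝓡 n; VE, E⟯ :=
  ⟨(χ : X → ℝ) • (trivializationAt VE E x₀).localFrame b a,
    ContMDiffOn.smul_section_of_tsupport χ.contMDiff.contMDiffOn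
      (trivializationAt VE E x₀).open_baseSet hχ
      (Trivialization.contMDiffOn_localFrame_baseSet ∞ _ b a)⟩

/-- The coefficient of `ξ` in the local frame of `cutoffFrame`, multiplied by `ρ` to a global
smooth function. -/
def cutoffCoeff (ρ : C^∞⟮𝓡 n, X; ℝ⟯) (hρ : tsupport ρ ⊆ (trivializationAt VE E x₀).baseSet)
    (a : κ) (ξ : Cₛ^∞⟮𝓡 n; VE, E⟯) : C^∞⟮𝓡 n, X; ℝ⟯ :=
  ⟨fun x ↦ ρ x * (trivializationAt VE E x₀).localFrameCoeff (𝓡 n) b a x (ξ x),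
    contMDiff_of_tsupport fun _ hx ↦ ρ.contMDiff.contMDiffAt.mul (contMDiffAt_localFrameCoeff b
      (hρ (tsupport_mul_subset_left hx)) ξ.contMDiff.contMDiffAt a)⟩

lemma abs_cutoffCoeff_le {ρ : C^∞⟮𝓡 n, X; ℝ⟯}
    (hρ : tsupport ρ ⊆ (trivializationAt VE E x₀).baseSet) (hρ1 : ∀ x, |ρ x| ≤ 1) {C : ℝ}
    (hC0 : 0 ≤ C)
    (hC : ∀ x ∈ tsupport ρ, ‖(trivializationAt VE E x₀).continuousLinearMapAt ℝ x‖ ≤ C) (a : κ)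
    (ξ : Cₛ^∞⟮𝓡 n; VE, E⟯) (x : X) :
    |cutoffCoeff b ρ hρ a ξ x| ≤
      ‖LinearMap.toContinuousLinearMap (b.coord a)‖ * C * ‖ξ x‖ := by
  change |ρ x * _| ≤ _
  rw [abs_mul]
  by_cases hx : x ∈ tsupport ρ
  · refine (mul_le_of_le_one_left (abs_nonneg _) (hρ1 x)).trans
      ((abs_localFrameCoeff_le b (hρ hx) a ξ).trans ?_)
    rw [mul_assoc]
    gcongr
    exact hC x hx
  · rw [image_eq_zero_of_notMem_tsupport hx, abs_zero, zero_mul]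
    positivity

lemma sum_smulSection_cutoff [Fintype κ] {ρ χ : C^∞⟮𝓡 n, X; ℝ⟯}
    (hρ : tsupport ρ ⊆ (trivializationAt VE E x₀).baseSet)
    (hχ : tsupport χ ⊆ (trivializationAt VE E x₀).baseSet) (hone : ∀ x ∈ tsupport ρ, χ x = 1)
    (ξ : Cₛ^∞⟮𝓡 n; VE, E⟯) :
    ∑ a, smulSection (cutoffCoeff b ρ hρ a ξ) (cutoffFrame b χ hχ a) = smulSection ρ ξ := by
  ext x
  rw [sum_smulSection_apply]
  change ∑ a, (ρ x * (trivializationAt VE E x₀).localFrameCoeff (𝓡 n) b a x (ξ x)) •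
    (χ x • (trivializationAt VE E x₀).localFrame b a x) = ρ x • ξ x
  by_cases hx : x ∈ tsupport ρ
  · simp only [hone x hx, one_smul, mul_smul]
    rw [← Finset.smul_sum, ← Trivialization.eq_sum_localFrameCoeff_smul (s := ξ) (hρ hx)]
  · simp only [image_eq_zero_of_notMem_tsupport hx, zero_mul, zero_smul, Finset.sum_const_zero]

variable (VE E) in
lemma exists_generating_sections [IsManifold (𝓡 n) ∞ X] [T2Space X] [CompactSpace X]
    [IsContMDiffRiemannianBundle (𝓡 n) ∞ VE E] :
    ∃ (ι : Type u) (_ : Fintype ι) (e : ι → Cₛ^∞⟮𝓡 n; VE, E⟯)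
      (c : ι → Cₛ^∞⟮𝓡 n; VE, E⟯ → C^∞⟮𝓡 n, X; ℝ⟯) (B : ℝ),
      (∀ a ξ x, |c a ξ x| ≤ B * ‖ξ x‖) ∧
        ∀ ξ : Cₛ^∞⟮𝓡 n; VE, E⟯, ∑ a, smulSection (c a ξ) (e a) = ξ := by
  have : IsContinuousRiemannianBundle VE E := isContinuousRiemannianBundle_of_contMDiff ‹_›
  choose C hC0 hC using fun x₀ : X ↦ eventually_norm_trivializationAt_lt VE E x₀
  choose W hWC hW hxW using fun x₀ : X ↦ mem_nhds_iff.1 (hC x₀)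
  obtain ⟨t, ρ, hsum, hρ1, hρ⟩ := exists_finite_partitionOfUnity (V := EuclideanSpace ℝ (Fin n))
    (fun x : X ↦ W x ∩ (trivializationAt VE E x).baseSet)
    (fun x ↦ (hW x).inter (trivializationAt VE E x).open_baseSet)
    (fun x ↦ ⟨hxW x, mem_baseSet_trivializationAt VE E x⟩)
  have hbase := fun i ↦ (hρ i).trans inter_subset_right
  choose χ hone hχ using fun i : t ↦ exists_contMDiffMap_eventuallyEq_one_tsupport_subset
    (V := EuclideanSpace ℝ (Fin n)) (isClosed_tsupport (ρ i))
    (trivializationAt VE E (i : X)).open_baseSet (hbase i)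
  let b := Module.finBasis ℝ VE
  let B : t × Fin (Module.finrank ℝ VE) → ℝ := fun p ↦
    ‖LinearMap.toContinuousLinearMap (b.coord p.2)‖ * C p.1
  refine ⟨t × Fin (Module.finrank ℝ VE), inferInstance, fun p ↦ cutoffFrame b (χ p.1) (hχ p.1) p.2,
    fun p ↦ cutoffCoeff b (ρ p.1) (hbase p.1) p.2, ∑ p, B p, fun p ξ x ↦ ?_, fun ξ ↦ ?_⟩
  · have hB0 : ∀ q, 0 ≤ B q := fun q ↦ mul_nonneg (norm_nonneg _) (hC0 _).le
    exact (abs_cutoffCoeff_le b (hbase p.1) (hρ1 p.1) (hC0 p.1).le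
      (fun x hx ↦ (hWC p.1 (hρ p.1 hx).1).le) p.2 ξ x).trans (mul_le_mul_of_nonneg_right
        (Finset.single_le_sum (fun q _ ↦ hB0 q) (Finset.mem_univ p)) (norm_nonneg _))
  · rw [Fintype.sum_prod_type]
    simp only [sum_smulSection_cutoff b (hbase _) (hχ _)
      fun _ hx ↦ (hone _).self_of_nhdsSet hx]
    ext x
    rw [sum_smulSection_apply, ← Finset.sum_smul, hsum, one_smul]

end GeneratingSections

section L2Form

variable {n : ℕ} {X : Type*} [TopologicalSpace X] [ChartedSpace (EuclideanSpace ℝ (Fin n)) X]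
  [RiemannianBundle (fun x : X ↦ TangentSpace (𝓡 n) x)] [MeasurableSpace X]
  {VF : Type*} [NormedAddCommGroup VF] [NormedSpace ℝ VF]
  {F : X → Type*} [TopologicalSpace (TotalSpace VF F)] [∀ x, NormedAddCommGroup (F x)]
  [FiberBundle VF F]

lemma l2Norm_sq (ξ : Cₛ^∞⟮𝓡 n; VF, F⟯) :
    l2Norm ξ ^ 2 = ∫ x, ‖ξ x‖ ^ 2 ∂(riemannianVolume n X) :=
  Real.sq_sqrt (integral_nonneg fun _ ↦ by positivity)

variable [∀ x, InnerProductSpace ℝ (F x)] [VectorBundle ℝ VF F]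
  [IsContMDiffRiemannianBundle (𝓡 n) ∞ VF F] [IsManifold (𝓡 n) ∞ X] [CompactSpace X]
  [IsContMDiffRiemannianBundle (𝓡 n) ∞ (EuclideanSpace ℝ (Fin n))
      (fun x : X ↦ TangentSpace (𝓡 n) x)]
  [BorelSpace X]

lemma integrable_inner_section (ξ η : Cₛ^∞⟮𝓡 n; VF, F⟯) :
    Integrable (fun x ↦ inner ℝ (ξ x) (η x)) (riemannianVolume n X) :=
  integrable_riemannianVolume_of_continuous
    (ContMDiff.inner_bundle ξ.contMDiff η.contMDiff).continuous

lemma integrable_norm_sq_section (ξ : Cₛ^∞⟮𝓡 n; VF, F⟯) :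
    Integrable (fun x ↦ ‖ξ x‖ ^ 2) (riemannianVolume n X) := by
  simpa only [real_inner_self_eq_norm_sq] using integrable_inner_section ξ ξ

variable (n F) in
/-- The `L²` inner product of smooth sections. -/
def l2Inner : LinearMap.BilinForm ℝ Cₛ^∞⟮𝓡 n; VF, F⟯ :=
  LinearMap.mk₂ ℝ (fun ξ η ↦ ∫ x, inner ℝ (ξ x) (η x) ∂(riemannianVolume n X))
    (fun ξ ξ' η ↦ by
      simp only [ContMDiffSection.coe_add, Pi.add_apply, inner_add_left]
      exact integral_add (integrable_inner_section ξ η) (integrable_inner_section ξ' η))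
    (fun r ξ η ↦ by
      simp only [ContMDiffSection.coe_smul, Pi.smul_apply, real_inner_smul_left, smul_eq_mul]
      exact integral_const_mul _ _)
    (fun ξ η η' ↦ by
      simp only [ContMDiffSection.coe_add, Pi.add_apply, inner_add_right]
      exact integral_add (integrable_inner_section ξ η) (integrable_inner_section ξ η'))
    (fun r ξ η ↦ by
      simp only [ContMDiffSection.coe_smul, Pi.smul_apply, real_inner_smul_right, smul_eq_mul]
      exact integral_const_mul _ _)

lemma l2Inner_apply (ξ η : Cₛ^∞⟮𝓡 n; VF, F⟯) :
    l2Inner n F ξ η = ∫ x, inner ℝ (ξ x) (η x) ∂(riemannianVolume n X) :=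
  rfl

lemma l2Inner_comm (ξ η : Cₛ^∞⟮𝓡 n; VF, F⟯) : l2Inner n F ξ η = l2Inner n F η ξ := by
  simp only [l2Inner_apply, real_inner_comm]

lemma l2Inner_self (ξ : Cₛ^∞⟮𝓡 n; VF, F⟯) : l2Inner n F ξ ξ = l2Norm ξ ^ 2 := by
  simp only [l2Inner_apply, real_inner_self_eq_norm_sq, l2Norm_sq]

lemma l2Norm_add_smul_sq (ξ η : Cₛ^∞⟮𝓡 n; VF, F⟯) (s : ℝ) :
    l2Norm (ξ + s • η) ^ 2 = l2Norm ξ ^ 2 + 2 * s * l2Inner n F ξ η + s ^ 2 * l2Norm η ^ 2 := by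
  simp only [← l2Inner_self, map_add, map_smul, LinearMap.add_apply, LinearMap.smul_apply,
    smul_eq_mul, l2Inner_comm η ξ]
  ring

end L2Form

section CrossTerm

variable {n : ℕ} {X : Type*} [TopologicalSpace X] [ChartedSpace (EuclideanSpace ℝ (Fin n)) X]
  {VE : Type*} [NormedAddCommGroup VE] [NormedSpace ℝ VE]
  {E : X → Type*} [TopologicalSpace (TotalSpace VE E)] [∀ x, NormedAddCommGroup (E x)]
  [∀ x, InnerProductSpace ℝ (E x)] [FiberBundle VE E] [VectorBundle ℝ VE E]
  {VF : Type*} [NormedAddCommGroup VF] [NormedSpace ℝ VF]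
  {F : X → Type*} [TopologicalSpace (TotalSpace VF F)] [∀ x, NormedAddCommGroup (F x)]
  [∀ x, InnerProductSpace ℝ (F x)] [FiberBundle VF F] [VectorBundle ℝ VF F]
  {D : Cₛ^∞⟮𝓡 n; VE, E⟯ →ₗ[ℝ] Cₛ^∞⟮𝓡 n; VF, F⟯}
  {σ : ∀ x : X, (TangentSpace (𝓡 n) x →L[ℝ] ℝ) →ₗ[ℝ] (E x →L[ℝ] F x)}
  {A : Cₛ^∞⟮𝓡 n; VE →L[ℝ] VF, fun x ↦ E x →L[ℝ] F x⟯}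

lemma IsConcentratingPair.inner_symbol_comm [FiniteDimensional ℝ VE] [FiniteDimensional ℝ VF]
    (hA : IsConcentratingPair σ A) {x : X} (u : TangentSpace (𝓡 n) x →L[ℝ] ℝ) (v w : E x) :
    inner ℝ (σ x u v) (A x w) = inner ℝ (σ x u w) (A x v) := by
  have := completeSpace_fiber VE (E := E) x
  have := completeSpace_fiber VF (E := F) x
  calc inner ℝ (σ x u v) (A x w) = inner ℝ ((A x).adjoint (σ x u v)) w :=
        ((A x).adjoint_inner_left _ _).symm
    _ = inner ℝ ((σ x u).adjoint (A x v)) w :=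
        congrArg (fun T : E x →L[ℝ] E x ↦ inner ℝ (T v) w) (hA x u)
    _ = inner ℝ (A x v) (σ x u w) := (σ x u).adjoint_inner_left _ _
    _ = inner ℝ (σ x u w) (A x v) := real_inner_comm _ _

variable (σ A) in
/-- The vector field `u ↦ ⟨σ(u) ξ, A η⟩`, through which the symbol of `D` enters the pairing of
`D` with `A`. -/
def crossField (ξ η : Cₛ^∞⟮𝓡 n; VE, E⟯) (x : X) : (TangentSpace (𝓡 n) x →L[ℝ] ℝ) →ₗ[ℝ] ℝ where
  toFun u := inner ℝ (σ x u (ξ x)) (A x (η x))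
  map_add' u v := by simp only [map_add, _root_.add_apply, inner_add_left]
  map_smul' r u := by
    simp only [map_smul, _root_.smul_apply, real_inner_smul_left, RingHom.id_apply, smul_eq_mul]

lemma inner_smulSection_eq (hD : HasSymbol D σ) (f : C^∞⟮𝓡 n, X; ℝ⟯) (ξ η : Cₛ^∞⟮𝓡 n; VE, E⟯)
    (x : X) :
    inner ℝ (D (smulSection f ξ) x) (bundleMapOp A η x) =
      crossField σ A ξ η x (mvfderiv (𝓡 n) f x) + f x * inner ℝ (D ξ x) (bundleMapOp A η x) := by
  rw [hD f ξ x, inner_add_left, real_inner_smul_left]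
  rfl

lemma isSmoothField_crossField [IsContMDiffRiemannianBundle (𝓡 n) ∞ VF F] (hD : HasSymbol D σ)
    (ξ η : Cₛ^∞⟮𝓡 n; VE, E⟯) : IsSmoothField (crossField σ A ξ η) := fun f ↦ by
  have hinner : ∀ α β : Cₛ^∞⟮𝓡 n; VF, F⟯,
      ContMDiff (𝓡 n) 𝓘(ℝ, ℝ) ∞ fun x ↦ inner ℝ (α x) (β x) :=
    fun α β ↦ ContMDiff.inner_bundle α.contMDiff β.contMDiff
  simp only [← sub_eq_of_eq_add (inner_smulSection_eq (A := A) hD f ξ η _)]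
  exact (hinner _ _).sub (f.contMDiff.mul (hinner _ _))

lemma inner_smulSection_add_inner_smulSection [FiniteDimensional ℝ VE]
    [FiniteDimensional ℝ VF] (hD : HasSymbol D σ) (hA : IsConcentratingPair σ A)
    (f g : C^∞⟮𝓡 n, X; ℝ⟯) (ξ η : Cₛ^∞⟮𝓡 n; VE, E⟯) (x : X) :
    inner ℝ (D (smulSection f ξ) x) (bundleMapOp A (smulSection g η) x) +
        inner ℝ (D (smulSection g η) x) (bundleMapOp A (smulSection f ξ) x) =
      crossField σ A ξ η x (mvfderiv (𝓡 n) (f * g : C^∞⟮𝓡 n, X; ℝ⟯) x) +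
        (f * g) x * (inner ℝ (D ξ x) (bundleMapOp A η x) +
          inner ℝ (D η x) (bundleMapOp A ξ x)) := by
  have hAsmul : ∀ (h : C^∞⟮𝓡 n, X; ℝ⟯) (ζ : Cₛ^∞⟮𝓡 n; VE, E⟯),
      bundleMapOp A (smulSection h ζ) x = h x • bundleMapOp A ζ x :=
    fun h ζ ↦ (A x).map_smul (h x) (ζ x)
  have hsymm : crossField σ A η ξ x = crossField σ A ξ η x :=
    LinearMap.ext fun u ↦ hA.inner_symbol_comm u (η x) (ξ x)
  rw [hAsmul, hAsmul, real_inner_smul_right, real_inner_smul_right, inner_smulSection_eq hD,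
    inner_smulSection_eq hD, hsymm, ContMDiffMap.coe_mul,
    mvfderiv_mul (f.contMDiff.mdifferentiableAt (by simp))
      (g.contMDiff.mdifferentiableAt (by simp)), map_add, map_smul, map_smul, Pi.mul_apply,
    smul_eq_mul, smul_eq_mul]
  ring

variable [RiemannianBundle (fun x : X ↦ TangentSpace (𝓡 n) x)] [MeasurableSpace X]
  [IsContMDiffRiemannianBundle (𝓡 n) ∞ VF F] [IsManifold (𝓡 n) ∞ X] [CompactSpace X]
  [IsContMDiffRiemannianBundle (𝓡 n) ∞ (EuclideanSpace ℝ (Fin n))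
      (fun x : X ↦ TangentSpace (𝓡 n) x)]
  [BorelSpace X]

variable (D A) in
/-- The symmetrization `⟨D ξ, A η⟩ + ⟨D η, A ξ⟩` of the cross term in the expansion of
`‖(D + s A) ξ‖²`. -/
def crossForm : LinearMap.BilinForm ℝ Cₛ^∞⟮𝓡 n; VE, E⟯ :=
  (l2Inner n F).compl₁₂ D (bundleMapOp A) + ((l2Inner n F).compl₁₂ D (bundleMapOp A)).flip

lemma crossForm_apply (ξ η : Cₛ^∞⟮𝓡 n; VE, E⟯) :
    crossForm D A ξ η = l2Inner n F (D ξ) (bundleMapOp A η) + l2Inner n F (D η) (bundleMapOp A ξ) :=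
  rfl

lemma exists_abs_integral_mul_le {h : X → ℝ} (hh : Continuous h) :
    ∃ C, 0 ≤ C ∧ ∀ f : C^∞⟮𝓡 n, X; ℝ⟯,
      |∫ x, f x * h x ∂(riemannianVolume n X)| ≤ C * ∫ x, |f x| ∂(riemannianVolume n X) := by
  obtain ⟨C, hC⟩ := isCompact_univ.exists_bound_of_continuousOn hh.continuousOn
  refine ⟨|C|, abs_nonneg C, fun f ↦ abs_integral_le_integral_abs.trans ?_⟩
  rw [← integral_const_mul]
  have hf : Continuous f := f.contMDiff.continuous
  refine integral_mono (integrable_riemannianVolume_of_continuous (hf.mul hh).abs)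
    (integrable_riemannianVolume_of_continuous (hf.abs.const_mul _)) fun x ↦ ?_
  rw [abs_mul, mul_comm]
  exact mul_le_mul_of_nonneg_right ((hC x (mem_univ x)).trans (le_abs_self C)) (abs_nonneg _)

variable [FiniteDimensional ℝ VE] [FiniteDimensional ℝ VF]

lemma crossForm_smulSection (hD : HasSymbol D σ) (hA : IsConcentratingPair σ A)
    (f g : C^∞⟮𝓡 n, X; ℝ⟯) (ξ η : Cₛ^∞⟮𝓡 n; VE, E⟯) :
    crossForm D A (smulSection f ξ) (smulSection g η) =
      ∫ x, crossField σ A ξ η x (mvfderiv (𝓡 n) (f * g : C^∞⟮𝓡 n, X; ℝ⟯) x)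
          ∂(riemannianVolume n X) +
        ∫ x, (f * g) x * (inner ℝ (D ξ x) (bundleMapOp A η x) +
          inner ℝ (D η x) (bundleMapOp A ξ x)) ∂(riemannianVolume n X) := by
  have hfield := (isSmoothField_crossField (A := A) hD ξ η (f * g)).continuous
  have hzero : Continuous fun x ↦ (f * g) x * (inner ℝ (D ξ x) (bundleMapOp A η x) +
      inner ℝ (D η x) (bundleMapOp A ξ x)) := (f * g).contMDiff.continuous.mul
    ((ContMDiff.inner_bundle (D ξ).contMDiff (bundleMapOp A η).contMDiff).add
      (ContMDiff.inner_bundle (D η).contMDiff (bundleMapOp A ξ).contMDiff)).continuous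
  rw [crossForm_apply, l2Inner_apply, l2Inner_apply, ← integral_add (integrable_inner_section _ _)
    (integrable_inner_section _ _), ← integral_add
    (integrable_riemannianVolume_of_continuous hfield)
    (integrable_riemannianVolume_of_continuous hzero)]
  exact integral_congr_ae (.of_forall fun x ↦
    inner_smulSection_add_inner_smulSection hD hA f g ξ η x)

lemma exists_abs_crossForm_smulSection_le [T2Space X] (hD : HasSymbol D σ)
    (hA : IsConcentratingPair σ A) (ξ η : Cₛ^∞⟮𝓡 n; VE, E⟯) :
    ∃ C, 0 ≤ C ∧ ∀ f g : C^∞⟮𝓡 n, X; ℝ⟯,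
      |crossForm D A (smulSection f ξ) (smulSection g η)| ≤
        C * ∫ x, |f x * g x| ∂(riemannianVolume n X) := by
  obtain ⟨C₁, hC₁, hfield⟩ := (isSmoothField_crossField (A := A) hD ξ η).exists_abs_integral_le
  obtain ⟨C₂, hC₂, hzero⟩ := exists_abs_integral_mul_le (n := n)
    ((ContMDiff.inner_bundle (D ξ).contMDiff (bundleMapOp A η).contMDiff).add
      (ContMDiff.inner_bundle (D η).contMDiff (bundleMapOp A ξ).contMDiff)).continuous
  refine ⟨C₁ + C₂, add_nonneg hC₁ hC₂, fun f g ↦ ?_⟩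
  rw [crossForm_smulSection hD hA, add_mul]
  exact (abs_add_le _ _).trans (add_le_add (hfield (f * g)) (hzero (f * g)))

end CrossTerm

section BilinearForms

variable {n : ℕ} {X : Type*} [TopologicalSpace X] [ChartedSpace (EuclideanSpace ℝ (Fin n)) X]
  {VE : Type*} [NormedAddCommGroup VE] [NormedSpace ℝ VE] [FiniteDimensional ℝ VE]
  {E : X → Type*} [TopologicalSpace (TotalSpace VE E)] [∀ x, NormedAddCommGroup (E x)]
  [∀ x, InnerProductSpace ℝ (E x)] [FiberBundle VE E] [VectorBundle ℝ VE E]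
  [ContMDiffVectorBundle ∞ VE E (𝓡 n)] [IsContMDiffRiemannianBundle (𝓡 n) ∞ VE E]
  [IsManifold (𝓡 n) ∞ X] [T2Space X] [CompactSpace X]
  [RiemannianBundle (fun x : X ↦ TangentSpace (𝓡 n) x)]
  [IsContMDiffRiemannianBundle (𝓡 n) ∞ (EuclideanSpace ℝ (Fin n))
      (fun x : X ↦ TangentSpace (𝓡 n) x)]
  [MeasurableSpace X] [BorelSpace X]

lemma exists_abs_bilinForm_self_le (Q : LinearMap.BilinForm ℝ Cₛ^∞⟮𝓡 n; VE, E⟯)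
    (hQ : ∀ ξ η, ∃ C, 0 ≤ C ∧ ∀ f g : C^∞⟮𝓡 n, X; ℝ⟯,
      |Q (smulSection f ξ) (smulSection g η)| ≤ C * ∫ x, |f x * g x| ∂(riemannianVolume n X)) :
    ∃ C, 0 ≤ C ∧ ∀ ξ, |Q ξ ξ| ≤ C * l2Norm ξ ^ 2 := by
  obtain ⟨ι, _, e, c, B, hB, hsum⟩ := exists_generating_sections (n := n) VE E
  choose C hC0 hC using fun a b ↦ hQ (e a) (e b)
  refine ⟨∑ a, ∑ b, C a b * B ^ 2, Finset.sum_nonneg fun a _ ↦ Finset.sum_nonneg fun b _ ↦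
    mul_nonneg (hC0 a b) (sq_nonneg B), fun ξ ↦ ?_⟩
  have hcoeff : ∀ a b, ∫ x, |c a ξ x * c b ξ x| ∂(riemannianVolume n X) ≤ B ^ 2 * l2Norm ξ ^ 2 := by
    intro a b
    rw [l2Norm_sq, ← integral_const_mul]
    refine integral_mono (integrable_riemannianVolume_of_continuous
      ((c a ξ).contMDiff.continuous.mul (c b ξ).contMDiff.continuous).abs)
      ((integrable_norm_sq_section ξ).const_mul _) fun x ↦ ?_
    calc |c a ξ x * c b ξ x| = |c a ξ x| * |c b ξ x| := abs_mul _ _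
      _ ≤ (B * ‖ξ x‖) * (B * ‖ξ x‖) := mul_le_mul (hB a ξ x) (hB b ξ x) (abs_nonneg _)
          ((abs_nonneg _).trans (hB a ξ x))
      _ = B ^ 2 * ‖ξ x‖ ^ 2 := by ring
  have hQsum : Q ξ ξ = ∑ a, ∑ b, Q (smulSection (c a ξ) (e a)) (smulSection (c b ξ) (e b)) := by
    have hright (a : ι) : Q (smulSection (c a ξ) (e a)) ξ =
        ∑ b, Q (smulSection (c a ξ) (e a)) (smulSection (c b ξ) (e b)) := by
      rw [← map_sum, hsum]
    simp only [← hright, ← LinearMap.sum_apply, ← map_sum, hsum]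
  rw [hQsum]
  simp only [Finset.sum_mul]
  refine (Finset.abs_sum_le_sum_abs _ _).trans (Finset.sum_le_sum fun a _ ↦
    (Finset.abs_sum_le_sum_abs _ _).trans (Finset.sum_le_sum fun b _ ↦ ?_))
  calc |Q (smulSection (c a ξ) (e a)) (smulSection (c b ξ) (e b))|
      ≤ C a b * ∫ x, |c a ξ x * c b ξ x| ∂(riemannianVolume n X) := hC a b _ _
    _ ≤ C a b * (B ^ 2 * l2Norm ξ ^ 2) := mul_le_mul_of_nonneg_left (hcoeff a b) (hC0 a b)
    _ = C a b * B ^ 2 * l2Norm ξ ^ 2 := (mul_assoc _ _ _).symm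

end BilinearForms

section Estimate

variable {n : ℕ} {X : Type*} [TopologicalSpace X] [ChartedSpace (EuclideanSpace ℝ (Fin n)) X]
  {VE : Type*} [NormedAddCommGroup VE] [NormedSpace ℝ VE]
  {E : X → Type*} [TopologicalSpace (TotalSpace VE E)] [∀ x, NormedAddCommGroup (E x)]
  [∀ x, InnerProductSpace ℝ (E x)] [FiberBundle VE E] [VectorBundle ℝ VE E]
  {VF : Type*} [NormedAddCommGroup VF] [NormedSpace ℝ VF]
  {F : X → Type*} [TopologicalSpace (TotalSpace VF F)] [∀ x, NormedAddCommGroup (F x)]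
  [∀ x, InnerProductSpace ℝ (F x)] [FiberBundle VF F] [VectorBundle ℝ VF F]
  [IsContMDiffRiemannianBundle (𝓡 n) ∞ VF F]
  {A : Cₛ^∞⟮𝓡 n; VE →L[ℝ] VF, fun x ↦ E x →L[ℝ] F x⟯}

lemma exists_mul_norm_le_of_disjoint_singularSet [FiniteDimensional ℝ VE]
    [IsContMDiffRiemannianBundle (𝓡 n) ∞ VE E] {K : Set X} (hK : IsCompact K)
    (hKA : Disjoint K (singularSet A)) : ∃ κ, 0 < κ ∧ ∀ x ∈ K, ∀ v, κ * ‖v‖ ≤ ‖A x v‖ := by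
  have hE : IsContinuousRiemannianBundle VE E :=
    isContinuousRiemannianBundle_of_contMDiff (n := n) inferInstance
  have hF : IsContinuousRiemannianBundle VF F :=
    isContinuousRiemannianBundle_of_contMDiff (n := n) inferInstance
  exact exists_mul_norm_fiber_le hK A.contMDiff.continuous fun x hx ↦
    not_not.1 (disjoint_left.1 hKA hx)

variable [IsManifold (𝓡 n) ∞ X] [CompactSpace X]
  [RiemannianBundle (fun x : X ↦ TangentSpace (𝓡 n) x)]
  [IsContMDiffRiemannianBundle (𝓡 n) ∞ (EuclideanSpace ℝ (Fin n))
      (fun x : X ↦ TangentSpace (𝓡 n) x)]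
  [MeasurableSpace X] [BorelSpace X]
  {D : Cₛ^∞⟮𝓡 n; VE, E⟯ →ₗ[ℝ] Cₛ^∞⟮𝓡 n; VF, F⟯}

lemma sq_mul_l2Norm_bundleMapOp_sq_le {C₁ s : ℝ} {ξ : Cₛ^∞⟮𝓡 n; VE, E⟯}
    (hcross : |l2Inner n F (D ξ) (bundleMapOp A ξ)| ≤ C₁ * l2Norm ξ ^ 2) :
    s ^ 2 * l2Norm (bundleMapOp A ξ) ^ 2 ≤
      l2Norm (perturbedOp D A s ξ) ^ 2 + 2 * |s| * C₁ * l2Norm ξ ^ 2 := by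
  have hexpand : l2Norm (perturbedOp D A s ξ) ^ 2 = l2Norm (D ξ) ^ 2 +
      2 * s * l2Inner n F (D ξ) (bundleMapOp A ξ) + s ^ 2 * l2Norm (bundleMapOp A ξ) ^ 2 :=
    l2Norm_add_smul_sq (D ξ) (bundleMapOp A ξ) s
  have hbound : -(s * l2Inner n F (D ξ) (bundleMapOp A ξ)) ≤ |s| * (C₁ * l2Norm ξ ^ 2) := by
    refine (neg_le_abs _).trans ?_
    rw [abs_mul]
    exact mul_le_mul_of_nonneg_left hcross (abs_nonneg s)
  linarith [sq_nonneg (l2Norm (D ξ))]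

variable [IsContMDiffRiemannianBundle (𝓡 n) ∞ VE E]

lemma sq_mul_setIntegral_norm_sq_le {K : Set X} (hK : MeasurableSet K) {κ : ℝ} (hκ : 0 ≤ κ)
    (hA : ∀ x ∈ K, ∀ v, κ * ‖v‖ ≤ ‖A x v‖) (ξ : Cₛ^∞⟮𝓡 n; VE, E⟯) :
    κ ^ 2 * ∫ x in K, ‖ξ x‖ ^ 2 ∂(riemannianVolume n X) ≤ l2Norm (bundleMapOp A ξ) ^ 2 := by
  have hint := integrable_norm_sq_section (bundleMapOp A ξ)
  rw [l2Norm_sq, ← integral_const_mul]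
  calc ∫ x in K, κ ^ 2 * ‖ξ x‖ ^ 2 ∂(riemannianVolume n X)
      ≤ ∫ x in K, ‖bundleMapOp A ξ x‖ ^ 2 ∂(riemannianVolume n X) := by
        refine setIntegral_mono_on ((integrable_norm_sq_section ξ).const_mul _).integrableOn
          hint.integrableOn hK fun x hx ↦ ?_
        rw [← mul_pow]
        exact pow_le_pow_left₀ (by positivity) (hA x hx (ξ x)) 2
    _ ≤ ∫ x, ‖bundleMapOp A ξ x‖ ^ 2 ∂(riemannianVolume n X) :=
        setIntegral_le_integral hint (.of_forall fun _ ↦ sq_nonneg _)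

lemma exists_abs_l2Inner_bundleMapOp_le [T2Space X] [ContMDiffVectorBundle ∞ VE E (𝓡 n)]
    [FiniteDimensional ℝ VE] [FiniteDimensional ℝ VF]
    {σ : ∀ x : X, (TangentSpace (𝓡 n) x →L[ℝ] ℝ) →ₗ[ℝ] (E x →L[ℝ] F x)}
    (hD : HasSymbol D σ) (hA : IsConcentratingPair σ A) :
    ∃ C, 0 ≤ C ∧ ∀ ξ, |l2Inner n F (D ξ) (bundleMapOp A ξ)| ≤ C * l2Norm ξ ^ 2 := by
  obtain ⟨C, hC, hform⟩ :=
    exists_abs_bilinForm_self_le (crossForm D A) (exists_abs_crossForm_smulSection_le hD hA)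
  refine ⟨C, hC, fun ξ ↦ le_trans ?_ (hform ξ)⟩
  rw [crossForm_apply, ← two_mul, abs_mul, abs_two]
  linarith [abs_nonneg (l2Inner n F (D ξ) (bundleMapOp A ξ))]

end Estimate

end Concentration

end

theorem proposition2p4_general {n : ℕ}
    {X : Type*} [TopologicalSpace X] [T2Space X] [CompactSpace X]
    [ChartedSpace (EuclideanSpace ℝ (Fin n)) X] [IsManifold (𝓡 n) ∞ X]
    [RiemannianBundle (fun x : X ↦ TangentSpace (𝓡 n) x)]
    [IsContMDiffRiemannianBundle (𝓡 n) ∞ (EuclideanSpace ℝ (Fin n))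
      (fun x : X ↦ TangentSpace (𝓡 n) x)]
    [MeasurableSpace X] [BorelSpace X]
    {VE : Type*} [NormedAddCommGroup VE] [NormedSpace ℝ VE] [FiniteDimensional ℝ VE]
    {E : X → Type*} [TopologicalSpace (TotalSpace VE E)] [∀ x, NormedAddCommGroup (E x)]
    [∀ x, InnerProductSpace ℝ (E x)] [FiberBundle VE E] [VectorBundle ℝ VE E]
    [ContMDiffVectorBundle ∞ VE E (𝓡 n)] [IsContMDiffRiemannianBundle (𝓡 n) ∞ VE E]
    {VF : Type*} [NormedAddCommGroup VF] [NormedSpace ℝ VF] [FiniteDimensional ℝ VF]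
    {F : X → Type*} [TopologicalSpace (TotalSpace VF F)] [∀ x, NormedAddCommGroup (F x)]
    [∀ x, InnerProductSpace ℝ (F x)] [FiberBundle VF F] [VectorBundle ℝ VF F]
    [IsContMDiffRiemannianBundle (𝓡 n) ∞ VF F]
    (D : Cₛ^∞⟮𝓡 n; VE, E⟯ →ₗ[ℝ] Cₛ^∞⟮𝓡 n; VF, F⟯)
    (σ : ∀ x : X, (TangentSpace (𝓡 n) x →L[ℝ] ℝ) →ₗ[ℝ] (E x →L[ℝ] F x))
    (hD : Concentration.HasSymbol D σ)
    (A : Cₛ^∞⟮𝓡 n; VE →L[ℝ] VF, fun x ↦ E x →L[ℝ] F x⟯)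
    (hA : Concentration.IsConcentratingPair σ A)
    {K : Set X} (hK : IsClosed K) (hKA : Disjoint K (Concentration.singularSet A)) (C : ℝ) :
    ∃ C' : ℝ, 0 < C' ∧
      ∀ s : ℝ, s ≠ 0 → ∀ ξ : Cₛ^∞⟮𝓡 n; VE, E⟯,
        Concentration.l2Norm ξ = 1 →
        Concentration.l2Norm (Concentration.perturbedOp D A s ξ) ^ 2 ≤ C * |s| →
        ∫ x in K, ‖ξ x‖ ^ 2 ∂(Concentration.riemannianVolume n X) < C' / |s| := by
  obtain ⟨C₁, hC₁, hcross⟩ := Concentration.exists_abs_l2Inner_bundleMapOp_le hD hA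
  obtain ⟨κ, hκ, hlow⟩ :=
    Concentration.exists_mul_norm_le_of_disjoint_singularSet hK.isCompact hKA
  refine ⟨(|C| + 2 * C₁ + 1) / κ ^ 2, by positivity, fun s hs ξ hξ hDs ↦ ?_⟩
  have hs0 : 0 < |s| := abs_pos.2 hs
  have hK' := Concentration.sq_mul_setIntegral_norm_sq_le hK.measurableSet hκ.le hlow ξ
  have hA' := Concentration.sq_mul_l2Norm_bundleMapOp_sq_le (s := s) (hcross ξ)
  set I := ∫ x in K, ‖ξ x‖ ^ 2 ∂(Concentration.riemannianVolume n X)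
  have hI : |s| * (|s| * (κ ^ 2 * I)) < |s| * (|C| + 2 * C₁ + 1) := calc
    |s| * (|s| * (κ ^ 2 * I)) = s ^ 2 * (κ ^ 2 * I) := by rw [← mul_assoc, ← sq, sq_abs]
    _ ≤ s ^ 2 * Concentration.l2Norm (Concentration.bundleMapOp A ξ) ^ 2 := by gcongr
    _ ≤ C * |s| + 2 * |s| * C₁ := by rw [hξ] at hA'; linarith
    _ < |s| * (|C| + 2 * C₁ + 1) := by linarith [mul_le_mul_of_nonneg_right (le_abs_self C) hs0.le]
  rw [lt_div_iff₀ hs0, lt_div_iff₀ (by positivity)]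
  linarith [lt_of_mul_lt_mul_left hI hs0.le]

theorem proposition2p4 {n : ℕ}
    {X : Type*} [EMetricSpace X] [CompactSpace X]
    [ChartedSpace (EuclideanSpace ℝ (Fin n)) X] [IsManifold (𝓡 n) ∞ X]
    [RiemannianBundle (fun x : X ↦ TangentSpace (𝓡 n) x)]
    [IsContMDiffRiemannianBundle (𝓡 n) ∞ (EuclideanSpace ℝ (Fin n))
      (fun x : X ↦ TangentSpace (𝓡 n) x)]
    [IsRiemannianManifold (𝓡 n) X]
    [MeasurableSpace X] [BorelSpace X]
    {VE : Type*} [NormedAddCommGroup VE] [NormedSpace ℝ VE] [FiniteDimensional ℝ VE]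
    {E : X → Type*} [TopologicalSpace (TotalSpace VE E)] [∀ x, NormedAddCommGroup (E x)]
    [∀ x, InnerProductSpace ℝ (E x)] [FiberBundle VE E] [VectorBundle ℝ VE E]
    [ContMDiffVectorBundle ∞ VE E (𝓡 n)] [IsContMDiffRiemannianBundle (𝓡 n) ∞ VE E]
    {VF : Type*} [NormedAddCommGroup VF] [NormedSpace ℝ VF] [FiniteDimensional ℝ VF]
    {F : X → Type*} [TopologicalSpace (TotalSpace VF F)] [∀ x, NormedAddCommGroup (F x)]
    [∀ x, InnerProductSpace ℝ (F x)] [FiberBundle VF F] [VectorBundle ℝ VF F]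
    [ContMDiffVectorBundle ∞ VF F (𝓡 n)] [IsContMDiffRiemannianBundle (𝓡 n) ∞ VF F]
    (D : Cₛ^∞⟮𝓡 n; VE, E⟯ →ₗ[ℝ] Cₛ^∞⟮𝓡 n; VF, F⟯)
    (σ : ∀ x : X, (TangentSpace (𝓡 n) x →L[ℝ] ℝ) →ₗ[ℝ] (E x →L[ℝ] F x))
    (hD : Concentration.HasSymbol D σ) (hσ : Concentration.IsElliptic σ)
    (A : Cₛ^∞⟮𝓡 n; VE →L[ℝ] VF, fun x ↦ E x →L[ℝ] F x⟯)
    (hA : Concentration.IsConcentratingPair σ A)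
    (δ : ℝ) (hδ : 0 < δ) (C : ℝ) (hC : 0 ≤ C) :
    ∃ C' : ℝ, 0 < C' ∧
      ∀ s : ℝ, s ≠ 0 → ∀ ξ : Cₛ^∞⟮𝓡 n; VE, E⟯,
        Concentration.l2Norm ξ = 1 →
        Concentration.l2Norm (Concentration.perturbedOp D A s ξ) ^ 2 ≤ C * |s| →
        ∫ x in (Metric.thickening δ (Concentration.singularSet A))ᶜ, ‖ξ x‖ ^ 2
          ∂(Concentration.riemannianVolume n X) < C' / |s| := by
  exact proposition2p4_general D σ hD A hA Metric.isOpen_thickening.isClosed_compl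
    (Set.disjoint_compl_left_iff_subset.2 (Metric.self_subset_thickening hδ _)) C
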